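/- Let $(S_n)_{n\in\mathbb N}$ be densely defined symmetric operators in complex Hilbert spaces $\mathfrak H_n$, and equip $\mathfrak H_{n+}:=\operatorname{dom}(S_n^*)$ with the graph norm $\|f\|_{\mathfrak H_{n+}}^2=\|f\|^2+\|S_n^*f\|^2$. For each $n$ let $\Pi_n=\{\mathcal H_n,\Gamma_0^{(n)},\Gamma_1^{(n)}\}$ be a boundary triplet for $S_n^*$: $\mathcal H_n$ is a Hilbert space, $\Gamma_0^{(n)},\Gamma_1^{(n)}:\mathfrak H_{n+}\to\mathcal H_n$ are bounded linear maps with $$(S_n^*f,g)-(f,S_n^*g)=(\Gamma_1^{(n)}f,\Gamma_0^{(n)}g)-(\Gamma_0^{(n)}f,\Gamma_1^{(n)}g),\qquad f,g\in\operatorname{dom}(S_n^*),$$ and $f\mapsto(\Gamma_0^{(n)}f,\Gamma_1^{(n)}f)$ maps $\operatorname{dom}(S_n^*)$ onto $\mathcal H_n\oplus\mathcal H_n$. Let $M_n(z)=\Gamma_1^{(n)}\bigl(\Gamma_0^{(n)}\!\upharpoonright\ker(S_n^*-z)\bigr)^{-1}$, $z\in\mathbb C\setminus\mathbb R$, be its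 Weyl function, and put $C_j=\sup_n\|\Gamma_j^{(n)}\|\in[0,\infty]$, $j=0,1$, with norms of maps $\mathfrak H_{n+}\to\mathcal H_n$. A direct sum $\bigoplus_n T_n$ of operators acts componentwise between the Hilbert direct sums, with domain $\{\oplus f_n: f_n\in\operatorname{dom}(T_n),\ \sum\|f_n\|^2<\infty,\ \sum\|T_nf_n\|^2<\infty\}$. Let $\mathfrak H=\bigoplus\mathfrak H_n$, $\mathcal H=\bigoplus\mathcal H_n$, $A=\bigoplus S_n$; then $A^*=\bigoplus S_n^*$. Let $\mathfrak H_+=\operatorname{dom}(A^*)$ with its graph norm. Define $$\Gamma_j=\bigoplus_n\Gamma_j^{(n)},\qquad \operatorname{dom}(\Gamma_j)=\Bigl\{f=\oplus f_n\in\operatorname{dom}(A^*):\sum_n\|\Gamma_j^{(n)}f_n\|^2<\infty\Bigr\},$$ $\Gamma=\{\Gamma_0,\Gamma_1\}$ on $\operatorname{dom}(\Gamma)=\operatorname{dom}(\Gamma_0)\cap\operatorname{dom}(\Gamma_1)$, $A_*=A^*\!\upharpoonright\operatorname{dom}(\Gamma)$, $A_{*j}=A_*\!\upharpoonright\ker\Gamma_j$,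 $S_{nj}=S_n^*\!\upharpoonright\ker\Gamma_j^{(n)}$, $\widetilde A_j=\bigoplus_nS_{nj}$; write $0'=1$, $1'=0$. Then: (i) $\Gamma$ is a single-valued boundary relation for $A^*$: $\operatorname{dom}(\Gamma)$ is dense in $\mathfrak H_+$; $(A_*f,g)-(f,A_*g)=(\Gamma_1f,\Gamma_0g)-(\Gamma_0f,\Gamma_1g)$ for $f,g\in\operatorname{dom}(\Gamma)$; and if $g,g'\in\mathfrak H$, $h,h'\in\mathcal H$ satisfy $(A_*f,g)-(f,g')=(\Gamma_1f,h)-(\Gamma_0f,h')$ for all $f\in\operatorname{dom}(\Gamma)$, then $g\in\operatorname{dom}(\Gamma)$ and $\Gamma g=\{h,h'\}$. (ii) For $z\in\mathbb C\setminus\mathbb R$ each $M_n(z)$ is a bounded everywhere defined operator in $\mathcal H_n$, and the Weyl function of $\Gamma$, i.e. the linear relation $M(z)=\{(\Gamma_0f,\Gamma_1f):f\in\operatorname{dom}(\Gamma),\ A^*f=zf\}$ in $\mathcal H$, is (the graph of) $M(z)=\bigoplus_nM_n(z)$. (iii) $\operatorname{ran}\Gamma$ is dense in $\mathcal H\oplus\mathcal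 H$. (iv) $\Gamma:\mathfrak H_+\to\mathcal H\oplus\mathcal H$ is closed, and $\Gamma_j:\mathfrak H_+\to\mathcal H$, $j=0,1$, are closable. (v) For the closure $\overline{\Gamma_j}$ of $\Gamma_j$, $j=0,1$, the following are equivalent: $\operatorname{dom}(\overline{\Gamma_j})=\mathfrak H_+$; $\overline{\Gamma_j}$ is a bounded operator from all of $\mathfrak H_+$ to $\mathcal H$; $C_j<\infty$. In particular $\operatorname{dom}(\Gamma)=\mathfrak H_+$ if and only if $\max\{C_0,C_1\}<\infty$. (vi) For $j=0,1$, $A_{*j}$ is essentially self-adjoint and $\overline{A_{*j}}=\widetilde A_j$. (vii) For $j=0,1$: if $C_{j'}<\infty$, then $A_{*j}$ is self-adjoint and $A_{*j}=\widetilde A_j$. If $\widetilde A_0$ and $\widetilde A_1$ are transversal, i.e. $\operatorname{dom}(\widetilde A_0)\cap\operatorname{dom}(\widetilde A_1)=\operatorname{dom}(\overline A)$ and $\operatorname{dom}(\widetilde A_0)+\operatorname{dom}(\widetilde A_1)=\operatorname{dom}(A^*)$, then $A_{*j}$ is self-adjoint if and only if $C_{j'}<\infty$. -/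

import Mathlib

open scoped LinearPMap

noncomputable section

namespace DirectSumTriplets

/-! ### The domain of an operator with its graph norm -/

section GraphDomain

variable {E F : Type*} [NormedAddCommGroup E] [InnerProductSpace ℂ E]
  [NormedAddCommGroup F] [InnerProductSpace ℂ F]

/-- The domain of a partially defined operator `T`; it carries the graph norm
`‖f‖₊² = ‖f‖² + ‖T f‖²`, see `GraphDom.norm_sq`. -/
def GraphDom (T : E →ₗ.[ℂ] F) : Type _ := T.domain

namespace GraphDom

variable (T : E →ₗ.[ℂ] F)

instance : AddCommGroup (GraphDom T) := inferInstanceAs (AddCommGroup T.domain)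

instance : Module ℂ (GraphDom T) := inferInstanceAs (Module ℂ T.domain)

/-- The identity map from the domain of `T` to the domain with the graph norm. -/
def ofDomain : T.domain ≃ₗ[ℂ] GraphDom T := LinearEquiv.refl ℂ T.domain

/-- The inclusion of the domain of `T` into the ambient space. -/
def incl : GraphDom T →ₗ[ℂ] E := T.domain.subtype ∘ₗ (ofDomain T).symm.toLinearMap

/-- The operator `T`, as a linear map on its domain. -/
def op : GraphDom T →ₗ[ℂ] F := T.toFun ∘ₗ (ofDomain T).symm.toLinearMap

/-- The map `f ↦ (f, T f)` into the Hilbert sum `E ⊕ F`. -/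
def toGraph : GraphDom T →ₗ[ℂ] WithLp 2 (E × F) :=
  (WithLp.linearEquiv 2 ℂ (E × F)).symm.toLinearMap ∘ₗ (incl T).prod (op T)

theorem toGraph_injective : Function.Injective (toGraph T) := by
  intro f g h
  have h' : incl T f = incl T g :=
    congrArg (fun p : WithLp 2 (E × F) => p.fst) h
  exact Subtype.ext h'

instance : NormedAddCommGroup (GraphDom T) :=
  NormedAddCommGroup.induced (GraphDom T) (WithLp 2 (E × F)) (toGraph T) (toGraph_injective T)

instance : NormedSpace ℂ (GraphDom T) :=
  NormedSpace.induced ℂ (GraphDom T) (WithLp 2 (E × F)) (toGraph T)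

theorem norm_sq (f : GraphDom T) : ‖f‖ ^ 2 = ‖incl T f‖ ^ 2 + ‖op T f‖ ^ 2 :=
  WithLp.prod_norm_sq_eq_of_L2 (toGraph T f)

end GraphDom

/-- The kernel of a partially defined operator, as a subspace of the ambient space. -/
def pmapKer {V W : Type*} [AddCommGroup V] [Module ℂ V] [AddCommGroup W] [Module ℂ W]
    (T : V →ₗ.[ℂ] W) : Submodule ℂ V :=
  (LinearMap.ker T.toFun).map T.domain.subtype

/-- The subspace `N_z = ker (T - z)` of the domain of `T`. -/
def eigenDom (T : E →ₗ.[ℂ] E) (z : ℂ) : Submodule ℂ (GraphDom T) :=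
  LinearMap.ker (GraphDom.op T - z • GraphDom.incl T)

/-- A partially defined operator is essentially self-adjoint if it is closable and its closure
is self-adjoint. -/
def IsEssentiallySelfAdjoint [CompleteSpace E] (T : E →ₗ.[ℂ] E) : Prop :=
  T.IsClosable ∧ IsSelfAdjoint T.closure

/-- Transversality of two proper extensions of a symmetric operator `A`: they are disjoint,
and their domains span the domain of `A†`. For a closed `A` one has `A.closure = A`. -/
structure IsTransversal [CompleteSpace E] (A A₀ A₁ : E →ₗ.[ℂ] E) : Prop where
  inf_eq : A₀.domain ⊓ A₁.domain = A.closure.domain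
  sup_eq : A₀.domain ⊔ A₁.domain = A†.domain

end GraphDomain

/-! ### Boundary triplets and boundary relations -/

section Boundary

variable {E : Type*} [NormedAddCommGroup E] [InnerProductSpace ℂ E] [CompleteSpace E]

/-- A boundary triplet `{G, Γ 0, Γ 1}` for `S†`. The maps `Γ j` are bounded for the graph norm.
Mathlib's `inner ℂ x y` is linear in `y`, so the scalar product `(x, y)`, linear in `x`, is
`inner ℂ y x`. -/
structure BoundaryTriplet (S : E →ₗ.[ℂ] E) (G : Type*) [NormedAddCommGroup G]
    [InnerProductSpace ℂ G] where
  Γ : Fin 2 → GraphDom S† →L[ℂ] G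
  green : ∀ f g : GraphDom S†,
    inner ℂ (GraphDom.incl S† g) (GraphDom.op S† f)
        - inner ℂ (GraphDom.op S† g) (GraphDom.incl S† f)
      = inner ℂ (Γ 0 g) (Γ 1 f) - inner ℂ (Γ 1 g) (Γ 0 f)
  surjective : Function.Surjective fun f : GraphDom S† => (Γ 0 f, Γ 1 f)

variable {G : Type*} [NormedAddCommGroup G] [InnerProductSpace ℂ G]

namespace BoundaryTriplet

variable {S : E →ₗ.[ℂ] E} (P : BoundaryTriplet S G)

/-- The `γ`-field `γ(z) = (Γ 0 ↾ N_z)⁻¹`. -/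
def gammaField (z : ℂ) : G →ₗ.[ℂ] GraphDom S† :=
  ((P.Γ 0 : GraphDom S† →ₗ[ℂ] G).toPMap (eigenDom S† z)).inverse

/-- The Weyl function `M(z) = Γ 1 γ(z)`. -/
def weyl (z : ℂ) : G →ₗ.[ℂ] G :=
  (P.Γ 1 : GraphDom S† →ₗ[ℂ] G).compPMap (P.gammaField z)

/-- The map `Γ j`, as a partially defined operator on the ambient Hilbert space with domain
`dom S†`. -/
def ΓPMap (j : Fin 2) : E →ₗ.[ℂ] G where
  domain := S†.domain
  toFun := (P.Γ j : GraphDom S† →ₗ[ℂ] G) ∘ₗ (GraphDom.ofDomain S†).toLinearMap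

/-- The extension `S_j = S† ↾ ker (Γ j)`. -/
def ext (j : Fin 2) : E →ₗ.[ℂ] E := S†.domRestrict (pmapKer (P.ΓPMap j))

end BoundaryTriplet

/-- A linear relation `Γ` from `E` to `G × G` is a boundary relation for `A†`, where `A` is a
densely defined symmetric operator: the domain of `Γ` is contained in `dom A†` and dense in it for
the graph norm, Green's identity holds on `Γ`, and `Γ` is maximal with this property. -/
structure IsBoundaryRelation (A : E →ₗ.[ℂ] E) (Γ : Submodule ℂ (E × (G × G))) : Prop where
  dense_domain : Dense (A.domain : Set E)
  symmetric : A.IsFormalAdjoint A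
  dom_le : Γ.map (LinearMap.fst ℂ E (G × G)) ≤ A†.domain
  dense : Dense {f : GraphDom A† | GraphDom.incl A† f ∈ Γ.map (LinearMap.fst ℂ E (G × G))}
  green : ∀ (f g : GraphDom A†) (l l' h h' : G),
    (GraphDom.incl A† f, (l, l')) ∈ Γ → (GraphDom.incl A† g, (h, h')) ∈ Γ →
    inner ℂ (GraphDom.incl A† g) (GraphDom.op A† f)
        - inner ℂ (GraphDom.op A† g) (GraphDom.incl A† f)
      = inner ℂ h l' - inner ℂ h' l
  maximal : ∀ (g g' : E) (h h' : G),
    (∀ (f : GraphDom A†) (l l' : G), (GraphDom.incl A† f, (l, l')) ∈ Γ →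
      inner ℂ g (GraphDom.op A† f) - inner ℂ g' (GraphDom.incl A† f)
        = inner ℂ h l' - inner ℂ h' l) →
    (g, (h, h')) ∈ Γ

/-- The value at `z` of the Weyl function (in general, Weyl family) of a boundary relation `Γ` for
`A†`: the linear relation `{(h, h') : (f, (h, h')) ∈ Γ for some f ∈ ker (A† - z)}` in `G`. -/
def weylRelation (A : E →ₗ.[ℂ] E) (Γ : Submodule ℂ (E × (G × G))) (z : ℂ) :
    Submodule ℂ (G × G) :=
  (Γ ⊓ ((eigenDom A† z).map (GraphDom.incl A†)).comap (LinearMap.fst ℂ E (G × G))).map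
    (LinearMap.snd ℂ E (G × G))

end Boundary

/-! ### Direct sums -/

section DirectSum

/-- The direct sum `⨁ T n` of partially defined operators between the Hilbert direct sums:
its domain consists of the `f` with `f n ∈ dom (T n)` and `∑ ‖T n (f n)‖² < ∞`. -/
def directSum {E F : ℕ → Type*}
    [∀ n, NormedAddCommGroup (E n)] [∀ n, InnerProductSpace ℂ (E n)]
    [∀ n, NormedAddCommGroup (F n)] [∀ n, InnerProductSpace ℂ (F n)]
    (T : ∀ n, E n →ₗ.[ℂ] F n) : lp E 2 →ₗ.[ℂ] lp F 2 where
  domain :=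
    { carrier := {f | ∃ h : ∀ n, f n ∈ (T n).domain, Memℓp (fun n => T n ⟨f n, h n⟩) 2}
      zero_mem' := ⟨fun n => (T n).domain.zero_mem, by
        convert (zero_memℓp : Memℓp (0 : ∀ n, F n) 2) using 1
        funext n
        exact (T n).map_zero⟩
      add_mem' := by
        rintro f g ⟨hf, hf'⟩ ⟨hg, hg'⟩
        refine ⟨fun n => (T n).domain.add_mem (hf n) (hg n), ?_⟩
        convert hf'.add hg' using 1
        funext n
        exact (T n).map_add ⟨f n, hf n⟩ ⟨g n, hg n⟩
      smul_mem' := by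
        rintro c f ⟨hf, hf'⟩
        refine ⟨fun n => (T n).domain.smul_mem c (hf n), ?_⟩
        convert hf'.const_smul c using 1
        funext n
        exact (T n).map_smul c ⟨f n, hf n⟩ }
  toFun :=
    { toFun := fun f => ⟨fun n => T n ⟨f.1 n, f.2.1 n⟩, f.2.2⟩
      map_add' := fun f g => by
        ext n
        exact (T n).map_add ⟨f.1 n, f.2.1 n⟩ ⟨g.1 n, g.2.1 n⟩
      map_smul' := fun c f => by
        ext n
        exact (T n).map_smul c ⟨f.1 n, f.2.1 n⟩ }

variable {H : ℕ → Type*} {K : ℕ → Type*}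
  [∀ n, NormedAddCommGroup (H n)] [∀ n, InnerProductSpace ℂ (H n)] [∀ n, CompleteSpace (H n)]
  [∀ n, NormedAddCommGroup (K n)] [∀ n, InnerProductSpace ℂ (K n)]
  {S : ∀ n, H n →ₗ.[ℂ] H n} (P : ∀ n, BoundaryTriplet (S n) (K n))

/-- The map `Γ_j = ⨁ Γ_j^(n)` from `dom A†` (with its graph norm) to `⨁ K n`, where `A = ⨁ S n`:
its domain consists of the `f ∈ dom A†` with `∑ ‖Γ_j^(n) (f n)‖² < ∞`. -/
def sumΓ (j : Fin 2) : GraphDom (directSum S)† →ₗ.[ℂ] lp K 2 where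
  domain := (directSum fun n => (P n).ΓPMap j).domain.comap (GraphDom.incl (directSum S)†)
  toFun := (directSum fun n => (P n).ΓPMap j).toFun ∘ₗ
    (GraphDom.incl (directSum S)†).restrict fun _ hf => hf

/-- The map `Γ = {Γ_0, Γ_1}` on `dom Γ_0 ∩ dom Γ_1`. -/
def sumΓPair : GraphDom (directSum S)† →ₗ.[ℂ] lp K 2 × lp K 2 where
  domain := (sumΓ P 0).domain ⊓ (sumΓ P 1).domain
  toFun := ((sumΓ P 0).toFun ∘ₗ Submodule.inclusion inf_le_left).prod
    ((sumΓ P 1).toFun ∘ₗ Submodule.inclusion inf_le_right)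

/-- The map `Γ = {Γ_0, Γ_1}` as a linear relation from `⨁ H n` to `(⨁ K n) × (⨁ K n)`. -/
def sumΓRel : Submodule ℂ (lp H 2 × (lp K 2 × lp K 2)) :=
  (sumΓPair P).graph.map ((GraphDom.incl (directSum S)†).prodMap LinearMap.id)

/-- The operator `A_* = A† ↾ dom Γ`. -/
def Astar : lp H 2 →ₗ.[ℂ] lp H 2 :=
  (directSum S)†.domRestrict ((sumΓPair P).domain.map (GraphDom.incl (directSum S)†))

/-- The operator `A_{*j} = A_* ↾ ker Γ_j`. -/
def AstarExt (j : Fin 2) : lp H 2 →ₗ.[ℂ] lp H 2 :=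
  (Astar P).domRestrict ((pmapKer (sumΓ P j)).map (GraphDom.incl (directSum S)†))

/-- The operator `Ã_j = ⨁ S_{nj}`, where `S_{nj} = S_n† ↾ ker Γ_j^(n)`. -/
def Atilde (j : Fin 2) : lp H 2 →ₗ.[ℂ] lp H 2 := directSum fun n => (P n).ext j

/-- The condition `C_j = sup_n ‖Γ_j^(n)‖ < ∞`. -/
def SupFinite (j : Fin 2) : Prop := BddAbove (Set.range fun n => ‖(P n).Γ j‖)

end DirectSum

end DirectSumTriplets

end

/-! Every operator and boundary map here is a direct sum, so membership in its graph can be tested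
component by component once both entries lie in the Hilbert sums (`mem_graph_directSum_iff`,
`mem_graph_sumΓ_iff`). Square-summability is the only condition that couples the components.
Closedness, maximality and the adjoint of a direct sum thus reduce to statements about a single
triplet.

Density comes from truncation: the partial sums of `GraphDom.hasSum_single_comp` converge in the
graph norm and have finitely many nonzero components, hence square-summable boundary values. This
gives the dense domain of `Γ` and, in `closure_AstarExt`, that `A_{*j}` has closure `Ã_j`. The
latter is self-adjoint because each `S_{nj}` is (`isSelfAdjoint_ext`).

For the Weyl function, Green's identity on `ker (S_n† - z)` gives `|Im z| ‖f‖² ≤ ‖Γ_0 f‖ ‖Γ_1 f‖`.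
Square-summable boundary values therefore force the eigenvectors themselves to be square-summable,
without any uniform bound on the triplets.

Boundedness is the closed graph theorem: `Γ_j` is closed, so an everywhere defined `Γ_j` is bounded,
and its norm dominates each `‖Γ_j^(n)‖` because the components embed isometrically. The operators
`A_{*j}` and `Ã_j` differ only by square-summability of the values of `Γ_{j'}`, which `C_{j'} < ∞`
makes automatic. Under transversality, `dom A†` is spanned by `dom Ã_j` and `dom Ã_{j'}`; if `A_{*j}
= Ã_j`, then `Γ_{j'}` is defined on both, hence everywhere. -/

noncomputable section

namespace DirectSumTriplets

/-! ### Graphs of partially defined operators and the graph norm -/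

section GraphNorm

variable {E F : Type*} [NormedAddCommGroup E] [InnerProductSpace ℂ E]
  [NormedAddCommGroup F] [InnerProductSpace ℂ F]

/-- The graph of the adjoint of a densely defined operator. -/
theorem mem_graph_adjoint_iff [CompleteSpace E] {T : E →ₗ.[ℂ] F}
    (hT : Dense (T.domain : Set E)) {y : F} {w : E} :
    (y, w) ∈ T†.graph ↔ ∀ x : T.domain, inner ℂ w (x : E) = inner ℂ y (T x) := by
  constructor
  · intro h x
    obtain ⟨u, hu, hu'⟩ := T†.mem_graph_iff.1 h
    dsimp only at hu hu'
    rw [← hu, ← hu']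
    exact LinearPMap.adjoint_isFormalAdjoint hT u x
  · intro h
    have hy : y ∈ T†.domain := LinearPMap.mem_adjoint_domain_of_exists y ⟨w, h⟩
    exact T†.mem_graph_iff.2 ⟨⟨y, hy⟩, rfl, LinearPMap.adjoint_apply_eq hT ⟨y, hy⟩ h⟩

/-- The graph of the restriction of an operator to a subspace. -/
theorem mem_graph_domRestrict_iff {T : E →ₗ.[ℂ] F} {p : Submodule ℂ E} {x : E} {y : F} :
    (x, y) ∈ (T.domRestrict p).graph ↔ x ∈ p ∧ (x, y) ∈ T.graph := by
  constructor
  · intro h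
    refine ⟨?_, LinearPMap.le_graph_of_le LinearPMap.domRestrict_le h⟩
    exact (LinearPMap.mem_domain_of_mem_graph h).1
  · rintro ⟨hx, h⟩
    obtain ⟨u, hu, hu'⟩ := T.mem_graph_iff.1 h
    dsimp only at hu hu'
    subst hu
    refine (T.domRestrict p).mem_graph_iff.2 ⟨⟨u, hx, u.2⟩, rfl, ?_⟩
    rw [← hu']
    exact LinearPMap.domRestrict_apply rfl

/-- A closed operator is its own closure. -/
theorem _root_.LinearPMap.IsClosed.closure_eq {V W : Type*} [NormedAddCommGroup V]
    [NormedSpace ℂ V] [NormedAddCommGroup W] [NormedSpace ℂ W] {T : V →ₗ.[ℂ] W}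
    (hT : T.IsClosed) : T.closure = T := by
  refine LinearPMap.eq_of_eq_graph ?_
  rw [← hT.isClosable.graph_closure_eq_closure_graph]
  exact hT.submodule_topologicalClosure_eq

namespace GraphDom

variable {T : E →ₗ.[ℂ] F}

theorem mem_graph (f : GraphDom T) : (incl T f, op T f) ∈ T.graph :=
  T.mem_graph ((ofDomain T).symm f)

theorem exists_of_mem_graph {x : E} {y : F} (h : (x, y) ∈ T.graph) :
    ∃ f : GraphDom T, incl T f = x ∧ op T f = y := by
  obtain ⟨u, hu, hu'⟩ := T.mem_graph_iff.1 h
  exact ⟨ofDomain T u, hu, hu'⟩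

theorem incl_injective : Function.Injective (incl T) :=
  fun _ _ h => Subtype.ext h

variable (T) in
/-- The map `f ↦ (f, T f)` induces the topology of the graph norm. -/
theorem isInducing_toGraph :
    Topology.IsInducing fun f : GraphDom T => (incl T f, op T f) :=
  (WithLp.homeomorphProd 2 E F).isInducing.comp ⟨rfl⟩

variable (T) in
theorem continuous_incl : Continuous (incl T) :=
  continuous_fst.comp (isInducing_toGraph T).continuous

variable (T) in
theorem continuous_op : Continuous (op T) :=
  continuous_snd.comp (isInducing_toGraph T).continuous

theorem hasSum_iff {ι : Type*} {u : ι → GraphDom T} {f : GraphDom T} :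
    HasSum u f ↔ HasSum (fun i => incl T (u i)) (incl T f) ∧
      HasSum (fun i => op T (u i)) (op T f) := by
  constructor
  · intro h
    exact ⟨h.map (incl T) (continuous_incl T), h.map (op T) (continuous_op T)⟩
  · rintro ⟨h₁, h₂⟩
    have h := h₁.prodMk h₂
    unfold HasSum at h ⊢
    rw [(isInducing_toGraph T).tendsto_nhds_iff]
    refine h.congr fun s => ?_
    simp [Prod.ext_iff, Prod.fst_sum, Prod.snd_sum]

/-- `toGraph` is an isometry onto the closed graph of `T`. Completeness is what the open mapping and
closed graph theorems need later. -/
theorem completeSpace [CompleteSpace E] [CompleteSpace F] (hT : T.IsClosed) :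
    CompleteSpace (GraphDom T) := by
  have h : IsUniformInducing (toGraph T) := ⟨rfl⟩
  rw [completeSpace_iff_isComplete_range h]
  refine IsClosed.isComplete ?_
  have : Set.range (toGraph T) = (WithLp.homeomorphProd 2 E F) ⁻¹' (T.graph : Set (E × F)) := by
    ext p
    constructor
    · rintro ⟨f, rfl⟩
      exact mem_graph f
    · intro hp
      obtain ⟨f, h₁, h₂⟩ := exists_of_mem_graph (T := T) (x := p.fst) (y := p.snd) hp
      refine ⟨f, ?_⟩
      apply (WithLp.homeomorphProd 2 E F).injective
      exact Prod.ext h₁ h₂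
  rw [this]
  exact IsClosed.preimage (WithLp.homeomorphProd 2 E F).continuous hT

end GraphDom

end GraphNorm

/-! ### Direct sums of operators -/

theorem memℓp_two_iff {E : ℕ → Type*} [∀ n, NormedAddCommGroup (E n)] {f : ∀ n, E n} :
    Memℓp f 2 ↔ Summable fun n => ‖f n‖ ^ 2 := by
  rw [memℓp_gen_iff (by simp)]
  simp

section DirectSumGraph

variable {E F : ℕ → Type*}
  [∀ n, NormedAddCommGroup (E n)] [∀ n, InnerProductSpace ℂ (E n)]
  [∀ n, NormedAddCommGroup (F n)] [∀ n, InnerProductSpace ℂ (F n)]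
  {T : ∀ n, E n →ₗ.[ℂ] F n}

/-- The graph of a direct sum is described componentwise. -/
theorem mem_graph_directSum_iff {f : lp E 2} {g : lp F 2} :
    (f, g) ∈ (directSum T).graph ↔ ∀ n, (f n, g n) ∈ (T n).graph := by
  constructor
  · intro h n
    obtain ⟨u, hu, hu'⟩ := (directSum T).mem_graph_iff.1 h
    dsimp only at hu hu'
    subst hu hu'
    exact (T n).mem_graph ⟨u.1 n, u.2.1 n⟩
  · intro h
    have hf : ∀ n, f n ∈ (T n).domain := fun n => LinearPMap.mem_domain_of_mem_graph (h n)
    have hg : (fun n => T n ⟨f n, hf n⟩) = g := by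
      funext n
      exact ((LinearPMap.image_iff (hf n)).2 (h n)).symm
    -- No summability has to be checked: `g` already lies in the Hilbert sum.
    have hmem : f ∈ (directSum T).domain := ⟨hf, by rw [hg]; exact lp.memℓp g⟩
    refine (directSum T).mem_graph_iff.2 ⟨⟨f, hmem⟩, rfl, ?_⟩
    ext n
    exact congrFun hg n

theorem single_mem_graph_directSum {n : ℕ} {x : E n} {y : F n} (h : (x, y) ∈ (T n).graph) :
    (lp.single 2 n x, lp.single 2 n y) ∈ (directSum T).graph := by
  refine mem_graph_directSum_iff.2 fun m => ?_
  rcases eq_or_ne m n with rfl | hm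
  · simpa using h
  · simp [hm]

theorem lp_hasSum_single {E : ℕ → Type*} [∀ n, NormedAddCommGroup (E n)] (f : lp E 2) : HasSum (fun n => lp.single 2 n (f n)) f :=
  lp.hasSum_single (by simp) f

theorem lp_continuous_apply (n : ℕ) : Continuous fun f : lp E 2 => f n :=
  (lp.evalCLM ℂ E 2 n).continuous

theorem dense_directSum_domain (hT : ∀ n, Dense ((T n).domain : Set (E n))) :
    Dense ((directSum T).domain : Set (lp E 2)) := by
  have key : ∀ f : lp E 2, f ∈ (directSum T).domain.topologicalClosure := by
    intro f
    refine (Submodule.isClosed_topologicalClosure _).mem_of_tendsto (lp_hasSum_single f)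
      (Filter.Eventually.of_forall fun s => Submodule.sum_mem _ fun n _ => ?_)
    have hcl : f n ∈ closure ((T n).domain : Set (E n)) := hT n (f n)
    refine map_mem_closure (lp.isometry_single (p := 2) n).continuous hcl fun x hx => ?_
    exact LinearPMap.mem_domain_of_mem_graph
      (single_mem_graph_directSum ((T n).mem_graph ⟨x, hx⟩))
  exact key

/-- The adjoint of a direct sum is the direct sum of the adjoints. -/
theorem adjoint_directSum [∀ n, CompleteSpace (E n)]
    (hT : ∀ n, Dense ((T n).domain : Set (E n))) :
    (directSum T)† = directSum fun n => (T n)† := by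
  refine LinearPMap.eq_of_eq_graph (SetLike.ext ?_)
  rintro ⟨g, g'⟩
  rw [mem_graph_adjoint_iff (T := directSum T) (dense_directSum_domain hT), mem_graph_directSum_iff]
  constructor
  · intro h n
    rw [mem_graph_adjoint_iff (hT n)]
    intro x
    -- Testing against vectors concentrated in the `n`-th component isolates the `n`-th condition.
    obtain ⟨u, hu, hu'⟩ := (directSum T).mem_graph_iff.1
      (single_mem_graph_directSum ((T n).mem_graph x))
    have := h u
    dsimp only at hu hu'
    rwa [hu, hu', lp.inner_single_right, lp.inner_single_right] at this
  · intro h f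
    rw [lp.inner_eq_tsum, lp.inner_eq_tsum]
    refine tsum_congr fun n => ?_
    exact (mem_graph_adjoint_iff (hT n)).1 (h n) ⟨f.1 n, f.2.1 n⟩

theorem isFormalAdjoint_directSum {R : ∀ n, F n →ₗ.[ℂ] E n}
    (h : ∀ n, (T n).IsFormalAdjoint (R n)) : (directSum T).IsFormalAdjoint (directSum R) := by
  intro f g
  rw [lp.inner_eq_tsum, lp.inner_eq_tsum]
  exact tsum_congr fun n => h n ⟨f.1 n, f.2.1 n⟩ ⟨g.1 n, g.2.1 n⟩

/-! ### Components and embeddings for the graph norm of a direct sum -/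

namespace GraphDom

variable {A : lp E 2 →ₗ.[ℂ] lp F 2} (hA : A = directSum T)

include hA in
theorem apply_mem_graph (f : GraphDom A) (n : ℕ) :
    (incl A f n, op A f n) ∈ (T n).graph := by
  subst hA
  exact mem_graph_directSum_iff.1 (mem_graph f) n

/-- The `n`-th component of an element of the domain of `⨁ T n`. -/
def comp (n : ℕ) : GraphDom A →ₗ[ℂ] GraphDom (T n) where
  toFun f := ofDomain (T n)
    ⟨incl A f n, LinearPMap.mem_domain_of_mem_graph (apply_mem_graph hA f n)⟩
  map_add' f g := incl_injective (by simp [incl])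
  map_smul' c f := incl_injective (by simp [incl])

@[simp]
theorem incl_comp (n : ℕ) (f : GraphDom A) : incl (T n) (comp hA n f) = incl A f n := rfl

@[simp]
theorem op_comp (n : ℕ) (f : GraphDom A) : op (T n) (comp hA n f) = op A f n :=
  (T n).mem_graph_snd_inj (mem_graph (comp hA n f)) (apply_mem_graph hA f n) rfl

theorem continuous_comp (n : ℕ) : Continuous (comp hA n) := by
  refine (isInducing_toGraph (T n)).continuous_iff.2 ?_
  refine Continuous.prodMk ?_ ?_
  · exact (lp_continuous_apply n).comp (continuous_incl A)
  · simp only [op_comp]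
    exact (lp_continuous_apply n).comp (continuous_op A)

include hA in
theorem summable_norm_comp_sq (f : GraphDom A) : Summable fun n => ‖comp hA n f‖ ^ 2 := by
  simp only [norm_sq, incl_comp, op_comp]
  exact (memℓp_two_iff.1 (lp.memℓp _)).add (memℓp_two_iff.1 (lp.memℓp _))

include hA in
/-- An element of the domain of `⨁ T n` may be given by its components. -/
theorem exists_of_comp (u : ∀ n, GraphDom (T n)) (h₁ : Memℓp (fun n => incl (T n) (u n)) 2)
    (h₂ : Memℓp (fun n => op (T n) (u n)) 2) : ∃ f : GraphDom A, ∀ n, comp hA n f = u n := by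
  have h : ((⟨_, h₁⟩ : lp E 2), (⟨_, h₂⟩ : lp F 2)) ∈ A.graph := by
    rw [hA]
    exact mem_graph_directSum_iff.2 fun n => mem_graph (u n)
  obtain ⟨f, hf, -⟩ := exists_of_mem_graph h
  refine ⟨f, fun n => incl_injective ?_⟩
  rw [incl_comp, hf]

/-- The embedding of the domain of `T n` into the domain of `⨁ T n`. -/
def single (n : ℕ) : GraphDom (T n) →ₗ[ℂ] GraphDom A where
  toFun u := ofDomain A ⟨lp.single 2 n (incl (T n) u), by
    rw [hA]
    exact LinearPMap.mem_domain_of_mem_graph (single_mem_graph_directSum (mem_graph u))⟩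
  map_add' f g := incl_injective (by simp [incl, lp.single_add])
  map_smul' c f := incl_injective (by simp [incl, lp.single_smul])

@[simp]
theorem incl_single (n : ℕ) (u : GraphDom (T n)) :
    incl A (single hA n u) = lp.single 2 n (incl (T n) u) := rfl

@[simp]
theorem op_single (n : ℕ) (u : GraphDom (T n)) :
    op A (single hA n u) = lp.single 2 n (op (T n) u) := by
  refine A.mem_graph_snd_inj (mem_graph (single hA n u)) ?_ rfl
  rw [incl_single]
  subst hA
  exact single_mem_graph_directSum (mem_graph u)

@[simp]
theorem comp_single_same (n : ℕ) (u : GraphDom (T n)) : comp hA n (single hA n u) = u :=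
  incl_injective (by simp)

theorem comp_single_of_ne {m n : ℕ} (h : m ≠ n) (u : GraphDom (T n)) :
    comp hA m (single hA n u) = 0 :=
  incl_injective (by simp [h])

theorem norm_single (n : ℕ) (u : GraphDom (T n)) : ‖single hA n u‖ = ‖u‖ := by
  rw [← sq_eq_sq₀ (norm_nonneg _) (norm_nonneg _), norm_sq, norm_sq, incl_single, op_single,
    lp.norm_single (by simp), lp.norm_single (by simp)]

/-- Both `f` and its image are sums of their components in the Hilbert sums, and graph-norm
convergence is exactly these two convergences. This is the truncation argument behind the density of
`dom Γ`. -/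
theorem hasSum_single_comp (f : GraphDom A) : HasSum (fun n => single hA n (comp hA n f)) f := by
  rw [hasSum_iff]
  simp only [incl_single, op_single, incl_comp, op_comp]
  exact ⟨lp_hasSum_single _, lp_hasSum_single _⟩

end GraphDom

end DirectSumGraph

/-! ### Boundary triplets -/

namespace BoundaryTriplet

variable {E : Type*} [NormedAddCommGroup E] [InnerProductSpace ℂ E] [CompleteSpace E]
  {G : Type*} [NormedAddCommGroup G] [InnerProductSpace ℂ G]
  {S : E →ₗ.[ℂ] E} (P : BoundaryTriplet S G)

/-- In `Fin 2` the map `j ↦ 1 - j` swaps the two indices, so this form of surjectivity treats both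
boundary maps at once. -/
theorem exists_Γ_eq (j : Fin 2) (a b : G) : ∃ f, P.Γ j f = a ∧ P.Γ (1 - j) f = b := by
  fin_cases j
  · obtain ⟨f, hf⟩ := P.surjective (a, b)
    exact ⟨f, congrArg Prod.fst hf, congrArg Prod.snd hf⟩
  · obtain ⟨f, hf⟩ := P.surjective (b, a)
    exact ⟨f, congrArg Prod.snd hf, congrArg Prod.fst hf⟩

/-- Boundary values are determined by the boundary form. -/
theorem eq_of_boundary_form_eq {h h' l l' : G}
    (H : ∀ f, inner ℂ h (P.Γ 1 f) - inner ℂ h' (P.Γ 0 f)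
      = inner ℂ l (P.Γ 1 f) - inner ℂ l' (P.Γ 0 f)) : h = l ∧ h' = l' := by
  constructor
  · refine ext_inner_right ℂ fun v => ?_
    obtain ⟨f, h₀, h₁⟩ := P.exists_Γ_eq 0 0 v
    have := H f
    simp only [sub_zero] at h₁
    simpa [h₀, h₁] using this
  · refine ext_inner_right ℂ fun v => ?_
    obtain ⟨f, h₀, h₁⟩ := P.exists_Γ_eq 0 v 0
    have := H f
    simp only [sub_zero] at h₁
    simpa [h₀, h₁] using this

/-- The boundary values vanish on the domain of the symmetric operator. -/
theorem Γ_eq_zero_of_mem_graph (hS : Dense (S.domain : Set E)) {f : GraphDom S†}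
    (hf : (GraphDom.incl S† f, GraphDom.op S† f) ∈ S.graph) (j : Fin 2) : P.Γ j f = 0 := by
  obtain ⟨u, hu, hu'⟩ := S.mem_graph_iff.1 hf
  dsimp only at hu hu'
  have H : ∀ g, inner ℂ (P.Γ 0 f) (P.Γ 1 g) - inner ℂ (P.Γ 1 f) (P.Γ 0 g)
      = inner ℂ (0 : G) (P.Γ 1 g) - inner ℂ (0 : G) (P.Γ 0 g) := by
    intro g
    have h := (mem_graph_adjoint_iff hS).1 (GraphDom.mem_graph g) u
    rw [hu, hu'] at h
    rw [← P.green g f, ← inner_conj_symm, h, inner_conj_symm]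
    simp
  obtain ⟨h₀, h₁⟩ := P.eq_of_boundary_form_eq H
  fin_cases j
  exacts [h₀, h₁]

/-- An element of the domain of the symmetric operator, as an element of the domain of its
adjoint. -/
theorem exists_of_mem_domain (hS : Dense (S.domain : Set E)) (hsymm : S.IsFormalAdjoint S)
    (x : S.domain) : ∃ f : GraphDom S†, GraphDom.incl S† f = x ∧ GraphDom.op S† f = S x ∧
      ∀ j, P.Γ j f = 0 := by
  obtain ⟨f, h₁, h₂⟩ := GraphDom.exists_of_mem_graph
    (LinearPMap.le_graph_of_le (hsymm.le_adjoint hS) (S.mem_graph x))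
  refine ⟨f, h₁, h₂, P.Γ_eq_zero_of_mem_graph hS ?_⟩
  rw [h₁, h₂]
  exact S.mem_graph x

/-- Both boundary maps vanish on `dom S`, so the test vectors `f` include all of `dom S`. -/
theorem mem_graph_adjoint_of_inner_eq (hS : Dense (S.domain : Set E))
    (hsymm : S.IsFormalAdjoint S) {g g' : E}
    (H : ∀ f : GraphDom S†, (∀ j, P.Γ j f = 0) →
      inner ℂ g' (GraphDom.incl S† f) = inner ℂ g (GraphDom.op S† f)) :
    (g, g') ∈ S†.graph := by
  rw [mem_graph_adjoint_iff hS]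
  intro x
  obtain ⟨f, h₁, h₂, hΓ⟩ := P.exists_of_mem_domain hS hsymm x
  rw [← h₁, ← h₂]
  exact H f hΓ

/-- A boundary triplet is maximal with respect to Green's identity. -/
theorem exists_of_green (hS : Dense (S.domain : Set E)) (hsymm : S.IsFormalAdjoint S)
    {g g' : E} {h h' : G}
    (H : ∀ f : GraphDom S†,
      inner ℂ g (GraphDom.op S† f) - inner ℂ g' (GraphDom.incl S† f)
        = inner ℂ h (P.Γ 1 f) - inner ℂ h' (P.Γ 0 f)) :
    ∃ u : GraphDom S†, GraphDom.incl S† u = g ∧ GraphDom.op S† u = g' ∧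
      P.Γ 0 u = h ∧ P.Γ 1 u = h' := by
  have hg : (g, g') ∈ S†.graph := by
    refine P.mem_graph_adjoint_of_inner_eq hS hsymm fun f hf => ?_
    have := H f
    rw [hf, hf, inner_zero_right, inner_zero_right, sub_zero, sub_eq_zero] at this
    exact this.symm
  obtain ⟨u, h₁, h₂⟩ := GraphDom.exists_of_mem_graph hg
  refine ⟨u, h₁, h₂, P.eq_of_boundary_form_eq fun f => ?_⟩
  rw [← H f, ← P.green f u, h₁, h₂]

/-! ### The extensions `S_j` -/

theorem mem_graph_ext_iff {j : Fin 2} {x y : E} :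
    (x, y) ∈ (P.ext j).graph ↔
      ∃ u : GraphDom S†, GraphDom.incl S† u = x ∧ GraphDom.op S† u = y ∧ P.Γ j u = 0 := by
  rw [ext, mem_graph_domRestrict_iff]
  constructor
  · rintro ⟨⟨w, hw, rfl⟩, h⟩
    obtain ⟨u, h₁, h₂⟩ := GraphDom.exists_of_mem_graph h
    refine ⟨u, h₁, h₂, ?_⟩
    have : u = GraphDom.ofDomain S† w := GraphDom.incl_injective h₁
    rw [this]
    exact hw
  · rintro ⟨u, rfl, rfl, hu⟩
    exact ⟨⟨(GraphDom.ofDomain S†).symm u, hu, rfl⟩, GraphDom.mem_graph u⟩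

theorem dense_ext_domain (hS : Dense (S.domain : Set E)) (hsymm : S.IsFormalAdjoint S)
    (j : Fin 2) : Dense ((P.ext j).domain : Set E) := by
  refine hS.mono fun x hx => ?_
  obtain ⟨f, h₁, h₂, hΓ⟩ := P.exists_of_mem_domain hS hsymm ⟨x, hx⟩
  exact LinearPMap.mem_domain_of_mem_graph (P.mem_graph_ext_iff.2 ⟨f, h₁, rfl, hΓ j⟩)

/-- The extensions `S_j` are self-adjoint. -/
theorem isSelfAdjoint_ext (hS : Dense (S.domain : Set E)) (hsymm : S.IsFormalAdjoint S)
    (j : Fin 2) : IsSelfAdjoint (P.ext j) := by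
  rw [LinearPMap.isSelfAdjoint_def]
  refine LinearPMap.eq_of_eq_graph (SetLike.ext ?_)
  rintro ⟨g, g'⟩
  have key : (g, g') ∈ (P.ext j)†.graph ↔ ∀ f : GraphDom S†, P.Γ j f = 0 →
      inner ℂ g' (GraphDom.incl S† f) = inner ℂ g (GraphDom.op S† f) := by
    rw [mem_graph_adjoint_iff (P.dense_ext_domain hS hsymm j)]
    constructor
    · intro h f hf
      obtain ⟨x, hx, hx'⟩ := (P.ext j).mem_graph_iff.1
        (P.mem_graph_ext_iff.2 ⟨f, rfl, rfl, hf⟩)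
      dsimp only at hx hx'
      rw [← hx, ← hx']
      exact h x
    · intro h x
      obtain ⟨f, h₁, h₂, hf⟩ := P.mem_graph_ext_iff.1 ((P.ext j).mem_graph x)
      rw [← h₁, ← h₂]
      exact h f hf
  rw [key, P.mem_graph_ext_iff]
  constructor
  · intro h
    obtain ⟨u, rfl, rfl⟩ := GraphDom.exists_of_mem_graph
      (P.mem_graph_adjoint_of_inner_eq hS hsymm fun f hf => h f (hf j))
    refine ⟨u, rfl, rfl, ?_⟩
    -- With this `f ∈ ker (Γ j)`, the boundary form of `f` and `u` is `±‖Γ j u‖²`, while `h` makes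
    -- it vanish.
    obtain ⟨f, hf, hf'⟩ := P.exists_Γ_eq j 0 (P.Γ j u)
    have hG := P.green f u
    rw [h f hf, sub_self] at hG
    fin_cases j
    · simp only [Fin.zero_eta, Fin.isValue, sub_zero] at hf hf' ⊢
      rw [hf, hf', inner_zero_right, sub_zero] at hG
      exact inner_self_eq_zero.1 hG.symm
    · simp only [Fin.mk_one, Fin.isValue, sub_self] at hf hf' ⊢
      rw [hf, hf', inner_zero_right, zero_sub] at hG
      exact inner_self_eq_zero.1 (neg_eq_zero.1 hG.symm)
  · rintro ⟨u, rfl, rfl, hu⟩ f hf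
    have hG := P.green f u
    fin_cases j
    · simp only [Fin.zero_eta, Fin.isValue] at hf hu
      rw [hf, hu, inner_zero_right, inner_zero_left, sub_zero, sub_eq_zero] at hG
      exact hG.symm
    · simp only [Fin.mk_one, Fin.isValue] at hf hu
      rw [hf, hu, inner_zero_right, inner_zero_left, sub_zero, sub_eq_zero] at hG
      exact hG.symm

/-! ### The Weyl function -/

theorem _root_.DirectSumTriplets.mem_eigenDom_iff {E : Type*} [NormedAddCommGroup E]
    [InnerProductSpace ℂ E] {T : E →ₗ.[ℂ] E} {z : ℂ} {f : GraphDom T} :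
    f ∈ eigenDom T z ↔ GraphDom.op T f = z • GraphDom.incl T f := by
  simp [eigenDom, LinearMap.mem_ker, sub_eq_zero]

/-- Green's identity with both arguments equal to `f` has left side `2i Im z ‖f‖²`; Cauchy–Schwarz
bounds the right side. The constant does not depend on the triplet, which is what makes the estimate
summable over `n`. -/
theorem abs_im_mul_norm_sq_le {z : ℂ} {f : GraphDom S†} (hf : f ∈ eigenDom S† z) :
    |z.im| * ‖GraphDom.incl S† f‖ ^ 2 ≤ ‖P.Γ 0 f‖ * ‖P.Γ 1 f‖ := by
  have hG := P.green f f
  rw [mem_eigenDom_iff.1 hf, inner_smul_right, inner_smul_left, ← sub_mul, Complex.sub_conj,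
    inner_self_eq_norm_sq_to_K] at hG
  have h := congrArg norm hG
  have h1 := norm_sub_le (inner ℂ (P.Γ 0 f) (P.Γ 1 f)) (inner ℂ (P.Γ 1 f) (P.Γ 0 f))
  have h2 := norm_inner_le_norm (𝕜 := ℂ) (P.Γ 0 f) (P.Γ 1 f)
  have h3 := norm_inner_le_norm (𝕜 := ℂ) (P.Γ 1 f) (P.Γ 0 f)
  rw [← h] at h1
  simp only [norm_mul, Complex.norm_I, Complex.norm_real, norm_pow, mul_one, Real.norm_eq_abs,
    abs_two, Complex.coe_algebraMap, abs_norm] at h1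
  nlinarith

theorem eq_zero_of_mem_eigenDom {z : ℂ} (hz : z.im ≠ 0) {f : GraphDom S†}
    (hf : f ∈ eigenDom S† z) (h₀ : P.Γ 0 f = 0) : f = 0 := by
  have h := P.abs_im_mul_norm_sq_le hf
  rw [h₀, norm_zero, zero_mul] at h
  have hz' : 0 < |z.im| := abs_pos.2 hz
  have : ‖GraphDom.incl S† f‖ ^ 2 ≤ 0 := by
    by_contra hc
    push Not at hc
    exact absurd h (not_le.2 (mul_pos hz' hc))
  refine GraphDom.incl_injective ?_
  rw [map_zero]
  exact norm_eq_zero.1 (pow_eq_zero_iff two_ne_zero |>.1 (le_antisymm this (sq_nonneg _)))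

/-- On `ker (Γ 0)` the form `(S† f, f)` is real by Green's identity, so the imaginary part of `((S†
- z) f, f)` is `-Im z ‖f‖²` (norm of the ambient space). -/
theorem norm_le_of_Γ_eq_zero {z : ℂ} {f : GraphDom S†} (h₀ : P.Γ 0 f = 0) :
    |z.im| * ‖GraphDom.incl S† f‖ ≤ ‖GraphDom.op S† f - z • GraphDom.incl S† f‖ := by
  have hG := P.green f f
  rw [h₀, inner_zero_left, inner_zero_right, sub_zero, sub_eq_zero] at hG
  have hreal : (inner ℂ (GraphDom.incl S† f) (GraphDom.op S† f)).im = 0 := by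
    rw [← inner_conj_symm, Complex.conj_eq_iff_im] at hG
    rw [← inner_conj_symm, Complex.conj_im, hG, neg_zero]
  have him : (inner ℂ (GraphDom.incl S† f)
      (GraphDom.op S† f - z • GraphDom.incl S† f)).im
        = -(z.im * ‖GraphDom.incl S† f‖ ^ 2) := by
    rw [inner_sub_right, inner_smul_right, Complex.sub_im, hreal, inner_self_eq_norm_sq_to_K,
      zero_sub]
    congr 1
    simp [← Complex.ofReal_pow]
  have h := (Complex.abs_im_le_norm _).trans (norm_inner_le_norm (𝕜 := ℂ) (GraphDom.incl S† f)
    (GraphDom.op S† f - z • GraphDom.incl S† f))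
  rw [him, abs_neg, abs_mul, abs_of_nonneg (sq_nonneg ‖_‖)] at h
  rcases (norm_nonneg (GraphDom.incl S† f)).eq_or_lt with h0 | hpos
  · rw [← h0, mul_zero]
    exact norm_nonneg _
  · refine le_of_mul_le_mul_left ?_ hpos
    linarith [h, sq ‖GraphDom.incl S† f‖, mul_assoc |z.im| ‖GraphDom.incl S† f‖
      ‖GraphDom.incl S† f‖, mul_comm ‖GraphDom.incl S† f‖ (|z.im| * ‖GraphDom.incl S† f‖),
      congrArg (|z.im| * ·) (sq ‖GraphDom.incl S† f‖)]

theorem _root_.DirectSumTriplets.GraphDom.norm_le_add {E : Type*}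
    [NormedAddCommGroup E] [InnerProductSpace ℂ E] {T : E →ₗ.[ℂ] E} (f : GraphDom T) :
    ‖f‖ ≤ ‖GraphDom.incl T f‖ + ‖GraphDom.op T f‖ := by
  refine le_of_sq_le_sq ?_ (by positivity)
  rw [GraphDom.norm_sq]
  nlinarith [mul_nonneg (norm_nonneg (GraphDom.incl T f)) (norm_nonneg (GraphDom.op T f))]

/-- The operator `S_0 - z` is onto for nonreal `z`. -/
theorem exists_op_sub_smul_eq (hS : Dense (S.domain : Set E)) (hsymm : S.IsFormalAdjoint S)
    {z : ℂ} (hz : z.im ≠ 0) (g : E) : ∃ f : GraphDom S†, P.Γ 0 f = 0 ∧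
      GraphDom.op S† f - z • GraphDom.incl S† f = g := by
  have hz' : 0 < |z.im| := abs_pos.2 hz
  have : CompleteSpace (GraphDom S†) := GraphDom.completeSpace (LinearPMap.adjoint_isClosed hS)
  let V : Submodule ℂ (GraphDom S†) := LinearMap.ker (P.Γ 0 : GraphDom S† →ₗ[ℂ] G)
  have hV : IsClosed (V : Set (GraphDom S†)) := (P.Γ 0).isClosed_ker
  have : CompleteSpace V := hV.completeSpace_coe
  let L₀ : GraphDom S† →L[ℂ] E :=
    ⟨GraphDom.op S† - z • GraphDom.incl S†,
      (GraphDom.continuous_op S†).sub ((GraphDom.continuous_incl S†).const_smul z)⟩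
  let L : V →L[ℂ] E := L₀.comp V.subtypeL
  have hL : ∀ f : V, L f = GraphDom.op S† f.1 - z • GraphDom.incl S† f.1 := fun f => rfl
  -- The graph norm is at most `‖f‖ + ‖S† f‖`, where `‖S† f‖ ≤ ‖L f‖ + ‖z‖ ‖f‖` and `‖f‖ ≤ ‖L f‖ /
  -- |Im z|`.
  let c : ℝ := 1 + (1 + ‖z‖) / |z.im|
  have hc : 0 ≤ c := by positivity
  have hbound : ∀ f : V, ‖f‖ ≤ (⟨c, hc⟩ : NNReal) * ‖L f‖ := by
    intro f
    have h1 : |z.im| * ‖GraphDom.incl S† f.1‖ ≤ ‖L f‖ := P.norm_le_of_Γ_eq_zero f.2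
    have h2 : ‖GraphDom.op S† f.1‖ ≤ ‖L f‖ + ‖z‖ * ‖GraphDom.incl S† f.1‖ := by
      rw [← norm_smul]
      calc ‖GraphDom.op S† f.1‖ = ‖L f + z • GraphDom.incl S† f.1‖ := by rw [hL, sub_add_cancel]
        _ ≤ _ := norm_add_le _ _
    have h3 : ‖GraphDom.incl S† f.1‖ ≤ ‖L f‖ / |z.im| := by
      rw [le_div_iff₀ hz', mul_comm]
      exact h1
    have h4 : (1 + ‖z‖) * ‖GraphDom.incl S† f.1‖ ≤ (1 + ‖z‖) * (‖L f‖ / |z.im|) := by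
      gcongr
    have h5 : c * ‖L f‖ = ‖L f‖ + (1 + ‖z‖) * (‖L f‖ / |z.im|) := by
      simp only [c]
      ring
    calc ‖f‖ = ‖f.1‖ := rfl
      _ ≤ _ := GraphDom.norm_le_add f.1
      _ ≤ c * ‖L f‖ := by rw [h5]; linarith
  have hclosed : IsClosed (Set.range L) :=
    (L.antilipschitz_of_bound hbound).isClosed_range L.uniformContinuous
  -- A vector orthogonal to the range is an eigenvector of `S_0† = S_0` for the nonreal number `star
  -- z`, hence zero.
  have hortho : (LinearMap.range L.toLinearMap)ᗮ = ⊥ := by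
    rw [Submodule.eq_bot_iff]
    intro g hg
    rw [Submodule.mem_orthogonal'] at hg
    have hmem : (g, star z • g) ∈ (P.ext 0)†.graph := by
      rw [mem_graph_adjoint_iff (P.dense_ext_domain hS hsymm 0)]
      intro x
      obtain ⟨f, h₁, h₂, hf⟩ := P.mem_graph_ext_iff.1 ((P.ext 0).mem_graph x)
      have := hg (L ⟨f, hf⟩) ⟨⟨f, hf⟩, rfl⟩
      rw [hL, inner_sub_right, sub_eq_zero, inner_smul_right] at this
      rw [← h₁, ← h₂, this, inner_smul_left]
      simp
    rw [LinearPMap.isSelfAdjoint_def.1 (P.isSelfAdjoint_ext hS hsymm 0),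
      P.mem_graph_ext_iff] at hmem
    obtain ⟨u, rfl, hu, hΓ⟩ := hmem
    have hu0 : u = 0 := P.eq_zero_of_mem_eigenDom (z := star z) (by simpa using hz)
      (mem_eigenDom_iff.2 hu) hΓ
    rw [hu0, map_zero]
  have htop : LinearMap.range L.toLinearMap = ⊤ := by
    rw [← Submodule.topologicalClosure_eq_top_iff] at hortho
    rw [← hortho]
    exact (IsClosed.submodule_topologicalClosure_eq hclosed).symm
  obtain ⟨f, hf⟩ : g ∈ LinearMap.range L.toLinearMap := htop ▸ Submodule.mem_top
  exact ⟨f.1, f.2, hf⟩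

/-- Take any `u` with `Γ 0 u = h` and subtract the `v ∈ ker (Γ 0)` that has the same image under `S†
- z`. -/
theorem exists_mem_eigenDom (hS : Dense (S.domain : Set E)) (hsymm : S.IsFormalAdjoint S)
    {z : ℂ} (hz : z.im ≠ 0) (h : G) : ∃ f ∈ eigenDom S† z, P.Γ 0 f = h := by
  obtain ⟨u, hu, -⟩ := P.exists_Γ_eq 0 h 0
  obtain ⟨v, hv, hv'⟩ := P.exists_op_sub_smul_eq hS hsymm hz
    (GraphDom.op S† u - z • GraphDom.incl S† u)
  refine ⟨u - v, ?_, by rw [map_sub, hu, hv, sub_zero]⟩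
  rw [mem_eigenDom_iff, map_sub, map_sub, smul_sub, sub_eq_sub_iff_sub_eq_sub]
  exact hv'.symm

theorem mem_graph_weyl_iff {z : ℂ} (hz : z.im ≠ 0) {a b : G} :
    (a, b) ∈ (P.weyl z).graph ↔ ∃ f ∈ eigenDom S† z, P.Γ 0 f = a ∧ P.Γ 1 f = b := by
  -- `LinearPMap.inverse` has the flipped graph only when the kernel is trivial; `z` nonreal
  -- guarantees this.
  have hker : LinearMap.ker
      ((P.Γ 0 : GraphDom S† →ₗ[ℂ] G).toPMap (eigenDom S† z)).toFun = ⊥ := by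
    rw [LinearMap.ker_eq_bot']
    intro f hf
    exact Subtype.ext (P.eq_zero_of_mem_eigenDom hz f.2 hf)
  have hγ : ∀ f : GraphDom S†, (a, f) ∈ (P.gammaField z).graph ↔
      f ∈ eigenDom S† z ∧ P.Γ 0 f = a := by
    intro f
    rw [gammaField, LinearPMap.inverse_graph hker]
    constructor
    · rintro ⟨⟨x, y⟩, hxy, h⟩
      obtain ⟨rfl, rfl⟩ := Prod.ext_iff.1 h
      obtain ⟨u, rfl, rfl⟩ := LinearPMap.mem_graph_iff _ |>.1 hxy
      exact ⟨u.2, rfl⟩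
    · rintro ⟨hf, rfl⟩
      exact ⟨(f, P.Γ 0 f), LinearPMap.mem_graph
        ((P.Γ 0 : GraphDom S† →ₗ[ℂ] G).toPMap (eigenDom S† z)) ⟨f, hf⟩, rfl⟩
  constructor
  · intro h
    obtain ⟨u, rfl, rfl⟩ := (P.weyl z).mem_graph_iff.1 h
    obtain ⟨h₁, h₂⟩ := (hγ _).1 ((P.gammaField z).mem_graph u)
    exact ⟨_, h₁, h₂, rfl⟩
  · rintro ⟨f, hf, h₁, rfl⟩
    obtain ⟨u, rfl, rfl⟩ := (P.gammaField z).mem_graph_iff.1 ((hγ f).2 ⟨hf, h₁⟩)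
    exact (P.weyl z).mem_graph u

/-- The values of the Weyl function are bounded everywhere defined operators. -/
theorem exists_weyl_eq_toPMap [CompleteSpace G] (hS : Dense (S.domain : Set E))
    (hsymm : S.IsFormalAdjoint S) {z : ℂ} (hz : z.im ≠ 0) :
    ∃ B : G →L[ℂ] G, P.weyl z = (B : G →ₗ[ℂ] G).toPMap ⊤ := by
  have : CompleteSpace (GraphDom S†) := GraphDom.completeSpace (LinearPMap.adjoint_isClosed hS)
  have hcl : IsClosed (eigenDom S† z : Set (GraphDom S†)) := by
    have : (eigenDom S† z : Set (GraphDom S†))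
        = {f | GraphDom.op S† f = z • GraphDom.incl S† f} := by
      ext f
      exact mem_eigenDom_iff
    rw [this]
    exact isClosed_eq (GraphDom.continuous_op S†)
      ((GraphDom.continuous_incl S†).const_smul z)
  have : CompleteSpace (eigenDom S† z) := hcl.completeSpace_coe
  let Φ : eigenDom S† z →L[ℂ] G := (P.Γ 0).comp (eigenDom S† z).subtypeL
  have hinj : LinearMap.ker Φ.toLinearMap = ⊥ := by
    rw [LinearMap.ker_eq_bot']
    intro f hf
    exact Subtype.ext (P.eq_zero_of_mem_eigenDom hz f.2 hf)
  have hsurj : LinearMap.range Φ.toLinearMap = ⊤ := by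
    rw [LinearMap.range_eq_top]
    intro h
    obtain ⟨f, hf, hf'⟩ := P.exists_mem_eigenDom hS hsymm hz h
    exact ⟨⟨f, hf⟩, hf'⟩
  -- By the open mapping theorem the `γ`-field is bounded from `G` into `N_z` with the graph norm.
  let e := ContinuousLinearEquiv.ofBijective Φ hinj hsurj
  refine ⟨((P.Γ 1).comp (eigenDom S† z).subtypeL).comp e.symm.toContinuousLinearMap, ?_⟩
  refine LinearPMap.eq_of_eq_graph (SetLike.ext ?_)
  rintro ⟨a, b⟩
  rw [P.mem_graph_weyl_iff hz, LinearPMap.mem_graph_iff]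
  constructor
  · rintro ⟨f, hf, h₀, rfl⟩
    refine ⟨⟨a, Submodule.mem_top⟩, rfl, ?_⟩
    have : e.symm a = ⟨f, hf⟩ := by
      rw [ContinuousLinearEquiv.symm_apply_eq]
      exact h₀.symm
    change P.Γ 1 (e.symm a).1 = P.Γ 1 f
    rw [this]
  · rintro ⟨x, rfl, rfl⟩
    exact ⟨(e.symm x).1, (e.symm x).2, e.apply_symm_apply x.1, rfl⟩

end BoundaryTriplet

/-! ### Direct sums of boundary triplets -/

section SumTriplets

variable {H : ℕ → Type*} {K : ℕ → Type*}
  [∀ n, NormedAddCommGroup (H n)] [∀ n, InnerProductSpace ℂ (H n)] [∀ n, CompleteSpace (H n)]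
  [∀ n, NormedAddCommGroup (K n)] [∀ n, InnerProductSpace ℂ (K n)]
  {S : ∀ n, H n →ₗ.[ℂ] H n} (P : ∀ n, BoundaryTriplet (S n) (K n))
  (hdense : ∀ n, Dense ((S n).domain : Set (H n)))

/-- The `n`-th component of an element of the domain of the adjoint of `⨁ S n`. -/
abbrev adjComp (n : ℕ) : GraphDom (directSum S)† →ₗ[ℂ] GraphDom (S n)† :=
  GraphDom.comp (adjoint_directSum hdense) n

/-- The embedding of the domain of the adjoint of `S n` into the domain of the adjoint of
`⨁ S n`. -/
abbrev adjSingle (n : ℕ) : GraphDom (S n)† →ₗ[ℂ] GraphDom (directSum S)† :=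
  GraphDom.single (adjoint_directSum hdense) n

theorem op_adjComp (n : ℕ) (f : GraphDom (directSum S)†) :
    GraphDom.op (S n)† (adjComp hdense n f) = GraphDom.op (directSum S)† f n :=
  GraphDom.op_comp (adjoint_directSum hdense) n f

theorem mem_graph_sumΓ_iff {j : Fin 2} {f : GraphDom (directSum S)†} {h : lp K 2} :
    (f, h) ∈ (sumΓ P j).graph ↔ ∀ n, (P n).Γ j (adjComp hdense n f) = h n := by
  have h₁ : (f, h) ∈ (sumΓ P j).graph ↔
      (GraphDom.incl (directSum S)† f, h) ∈ (directSum fun n => (P n).ΓPMap j).graph := by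
    rw [LinearPMap.mem_graph_iff, LinearPMap.mem_graph_iff]
    constructor
    · rintro ⟨u, rfl, rfl⟩
      exact ⟨⟨_, u.2⟩, rfl, rfl⟩
    · rintro ⟨⟨u, hu⟩, rfl, hu'⟩
      exact ⟨⟨f, hu⟩, rfl, hu'⟩
  rw [h₁, mem_graph_directSum_iff]
  refine forall_congr' fun n => ?_
  rw [LinearPMap.mem_graph_iff]
  constructor
  · rintro ⟨u, hu, hu'⟩
    have : adjComp hdense n f = GraphDom.ofDomain _ u := GraphDom.incl_injective hu.symm
    rw [this]
    exact hu'
  · intro hn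
    exact ⟨(GraphDom.ofDomain _).symm (adjComp hdense n f), rfl, hn⟩

theorem mem_domain_sumΓ_iff {j : Fin 2} {f : GraphDom (directSum S)†} :
    f ∈ (sumΓ P j).domain ↔ Memℓp (fun n => (P n).Γ j (adjComp hdense n f)) 2 := by
  rw [LinearPMap.mem_domain_iff]
  constructor
  · rintro ⟨h, hh⟩
    rw [mem_graph_sumΓ_iff P hdense] at hh
    rw [funext hh]
    exact lp.memℓp h
  · intro h
    exact ⟨⟨_, h⟩, (mem_graph_sumΓ_iff P hdense).2 fun n => rfl⟩

theorem mem_graph_sumΓPair_iff {f : GraphDom (directSum S)†} {h h' : lp K 2} :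
    (f, (h, h')) ∈ (sumΓPair P).graph ↔ (∀ n, (P n).Γ 0 (adjComp hdense n f) = h n) ∧
      ∀ n, (P n).Γ 1 (adjComp hdense n f) = h' n := by
  rw [← mem_graph_sumΓ_iff, ← mem_graph_sumΓ_iff, LinearPMap.mem_graph_iff]
  constructor
  · rintro ⟨u, rfl, hu⟩
    obtain ⟨rfl, rfl⟩ := Prod.ext_iff.1 hu
    exact ⟨(sumΓ P 0).mem_graph ⟨u.1, u.2.1⟩, (sumΓ P 1).mem_graph ⟨u.1, u.2.2⟩⟩
  · rintro ⟨h₀, h₁⟩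
    refine ⟨⟨f, LinearPMap.mem_domain_of_mem_graph h₀, LinearPMap.mem_domain_of_mem_graph h₁⟩,
      rfl, Prod.ext ?_ ?_⟩
    · exact ((LinearPMap.image_iff _).2 h₀).symm
    · exact ((LinearPMap.image_iff _).2 h₁).symm

theorem mem_sumΓRel_iff {x : lp H 2} {h h' : lp K 2} :
    (x, (h, h')) ∈ sumΓRel P ↔ ∃ f : GraphDom (directSum S)†, GraphDom.incl _ f = x ∧
      (∀ n, (P n).Γ 0 (adjComp hdense n f) = h n) ∧
      ∀ n, (P n).Γ 1 (adjComp hdense n f) = h' n := by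
  constructor
  · rintro ⟨⟨f, l, l'⟩, hf, hx⟩
    simp only [LinearMap.prodMap_apply, LinearMap.id_apply, Prod.mk.injEq] at hx
    obtain ⟨rfl, rfl, rfl⟩ := hx
    exact ⟨f, rfl, (mem_graph_sumΓPair_iff P hdense).1 hf⟩
  · rintro ⟨f, rfl, hf⟩
    exact ⟨(f, (h, h')), (mem_graph_sumΓPair_iff P hdense).2 hf, rfl⟩

theorem incl_mem_sumΓRel_iff {f : GraphDom (directSum S)†} {h h' : lp K 2} :
    (GraphDom.incl _ f, (h, h')) ∈ sumΓRel P ↔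
      (∀ n, (P n).Γ 0 (adjComp hdense n f) = h n) ∧
      ∀ n, (P n).Γ 1 (adjComp hdense n f) = h' n := by
  rw [mem_sumΓRel_iff P hdense]
  constructor
  · rintro ⟨u, hu, h⟩
    rwa [← GraphDom.incl_injective hu]
  · intro h
    exact ⟨f, rfl, h⟩

/-- On `ker Γ_j` the values of `Γ_j` are trivially square-summable, so only the summability of the
other boundary values remains. This last clause is the whole difference from `mem_graph_Atilde_iff`.
-/
theorem mem_graph_AstarExt_iff {j : Fin 2} {x y : lp H 2} :
    (x, y) ∈ (AstarExt P j).graph ↔ ∃ f : GraphDom (directSum S)†, GraphDom.incl _ f = x ∧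
      GraphDom.op _ f = y ∧ (∀ n, (P n).Γ j (adjComp hdense n f) = 0) ∧
      Memℓp (fun n => (P n).Γ (1 - j) (adjComp hdense n f)) 2 := by
  have hker : ∀ f : GraphDom (directSum S)†, f ∈ pmapKer (sumΓ P j) ↔
      ∀ n, (P n).Γ j (adjComp hdense n f) = 0 := by
    intro f
    have h₁ : f ∈ pmapKer (sumΓ P j) ↔ (f, 0) ∈ (sumΓ P j).graph := by
      rw [LinearPMap.mem_graph_iff]
      constructor
      · rintro ⟨u, hu, rfl⟩
        exact ⟨u, rfl, hu⟩
      · rintro ⟨u, rfl, hu⟩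
        exact ⟨u, hu, rfl⟩
    rw [h₁, mem_graph_sumΓ_iff P hdense]
    rfl
  have hdom : ∀ f : GraphDom (directSum S)†, (∀ n, (P n).Γ j (adjComp hdense n f) = 0) →
      (f ∈ (sumΓPair P).domain ↔
        Memℓp (fun n => (P n).Γ (1 - j) (adjComp hdense n f)) 2) := by
    intro f hf
    have hj : f ∈ (sumΓ P j).domain := by
      rw [mem_domain_sumΓ_iff P hdense, funext hf]
      exact zero_memℓp
    have h₂ : f ∈ (sumΓPair P).domain ↔ f ∈ (sumΓ P 0).domain ∧ f ∈ (sumΓ P 1).domain := Iff.rfl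
    rw [h₂, ← mem_domain_sumΓ_iff P hdense]
    fin_cases j
    · exact ⟨fun h => h.2, fun h => ⟨hj, h⟩⟩
    · exact ⟨fun h => h.1, fun h => ⟨h, hj⟩⟩
  rw [AstarExt, mem_graph_domRestrict_iff, Astar, mem_graph_domRestrict_iff]
  constructor
  · rintro ⟨⟨f, hf, rfl⟩, ⟨g, hg, hgf⟩, h⟩
    obtain rfl := GraphDom.incl_injective hgf
    have h0 := (hker g).1 hf
    exact ⟨g, rfl, LinearPMap.mem_graph_snd_inj _ (GraphDom.mem_graph g) h rfl, h0,
      (hdom g h0).1 hg⟩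
  · rintro ⟨f, rfl, rfl, h0, hf⟩
    exact ⟨⟨f, (hker f).2 h0, rfl⟩, ⟨f, (hdom f h0).2 hf, rfl⟩, GraphDom.mem_graph f⟩

theorem mem_graph_Atilde_iff {j : Fin 2} {x y : lp H 2} :
    (x, y) ∈ (Atilde P j).graph ↔ ∃ f : GraphDom (directSum S)†, GraphDom.incl _ f = x ∧
      GraphDom.op _ f = y ∧ ∀ n, (P n).Γ j (adjComp hdense n f) = 0 := by
  rw [Atilde, mem_graph_directSum_iff]
  constructor
  · intro h
    choose u h₁ h₂ h₃ using fun n => (P n).mem_graph_ext_iff.1 (h n)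
    have hxy : (x, y) ∈ (directSum S)†.graph := by
      rw [adjoint_directSum hdense, mem_graph_directSum_iff]
      intro n
      rw [← h₁ n, ← h₂ n]
      exact GraphDom.mem_graph (u n)
    obtain ⟨f, rfl, rfl⟩ := GraphDom.exists_of_mem_graph hxy
    refine ⟨f, rfl, rfl, fun n => ?_⟩
    have : adjComp hdense n f = u n := GraphDom.incl_injective (h₁ n).symm
    rw [this, h₃]
  · rintro ⟨f, rfl, rfl, h0⟩ n
    exact (P n).mem_graph_ext_iff.2 ⟨adjComp hdense n f, rfl, op_adjComp hdense n f, h0 n⟩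

/-! ### `Γ` is a boundary relation -/

theorem Γ_adjComp_adjSingle {j : Fin 2} (n : ℕ) (u : GraphDom (S n)†) :
    (fun m => (P m).Γ j (adjComp hdense m (adjSingle hdense n u)))
      = lp.single (E := K) 2 n ((P n).Γ j u) := by
  funext m
  rcases eq_or_ne m n with rfl | hm
  · simp
  · rw [adjComp, GraphDom.comp_single_of_ne _ hm, map_zero, lp.single_apply_ne _ _ _ hm]

theorem single_mem_graph_sumΓPair (n : ℕ) (u : GraphDom (S n)†) :
    (adjSingle hdense n u, (lp.single 2 n ((P n).Γ 0 u), lp.single 2 n ((P n).Γ 1 u)))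
      ∈ (sumΓPair P).graph :=
  (mem_graph_sumΓPair_iff P hdense).2
    ⟨congrFun (Γ_adjComp_adjSingle P hdense n u), congrFun (Γ_adjComp_adjSingle P hdense n u)⟩

include hdense in
theorem dense_sumΓPair_domain : Dense ((sumΓPair P).domain : Set (GraphDom (directSum S)†)) := by
  have key : ∀ f, f ∈ (sumΓPair P).domain.topologicalClosure := fun f =>
    (Submodule.isClosed_topologicalClosure _).mem_of_tendsto
      (GraphDom.hasSum_single_comp (adjoint_directSum hdense) f)
      (Filter.Eventually.of_forall fun s => Submodule.sum_mem _ fun n _ =>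
        Submodule.le_topologicalClosure _ (LinearPMap.mem_domain_of_mem_graph
          (single_mem_graph_sumΓPair P hdense n (adjComp hdense n f))))
  exact key

include hdense in
theorem isBoundaryRelation_sumΓRel (hsymm : ∀ n, (S n).IsFormalAdjoint (S n)) :
    IsBoundaryRelation (directSum S) (sumΓRel P) where
  dense_domain := dense_directSum_domain hdense
  symmetric := isFormalAdjoint_directSum hsymm
  dom_le := by
    rintro - ⟨⟨x, h, h'⟩, hx, rfl⟩
    obtain ⟨f, rfl, -⟩ := (mem_sumΓRel_iff P hdense).1 hx
    exact LinearPMap.mem_domain_of_mem_graph (GraphDom.mem_graph f)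
  dense := by
    refine (dense_sumΓPair_domain P hdense).mono fun f hf => ?_
    exact ⟨_, ⟨_, (sumΓPair P).mem_graph ⟨f, hf⟩, rfl⟩, rfl⟩
  green := by
    intro f g l l' h h' hf hg
    obtain ⟨hf₀, hf₁⟩ := (incl_mem_sumΓRel_iff P hdense).1 hf
    obtain ⟨hg₀, hg₁⟩ := (incl_mem_sumΓRel_iff P hdense).1 hg
    have hleft := (lp.hasSum_inner (𝕜 := ℂ) (GraphDom.incl (directSum S)† g)
      (GraphDom.op (directSum S)† f)).sub (lp.hasSum_inner (𝕜 := ℂ)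
      (GraphDom.op (directSum S)† g) (GraphDom.incl (directSum S)† f))
    have hright := (lp.hasSum_inner (𝕜 := ℂ) h l').sub (lp.hasSum_inner (𝕜 := ℂ) h' l)
    refine hleft.unique ?_
    convert hright using 2 with n
    have hG := (P n).green (adjComp hdense n f) (adjComp hdense n g)
    rwa [hf₀, hf₁, hg₀, hg₁, op_adjComp, op_adjComp] at hG
  maximal := by
    intro g g' h h' H
    -- Testing on vectors with one nonzero component reduces maximality to that of each triplet. The
    -- components then reassemble because `g`, `g'`, `h`, `h'` lie in the Hilbert sums.
    have key : ∀ n, ∃ u : GraphDom (S n)†, GraphDom.incl _ u = g n ∧ GraphDom.op _ u = g' n ∧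
        (P n).Γ 0 u = h n ∧ (P n).Γ 1 u = h' n := by
      intro n
      refine (P n).exists_of_green (hdense n) (hsymm n) fun u => ?_
      have := H (adjSingle hdense n u) _ _
        ⟨_, single_mem_graph_sumΓPair P hdense n u, rfl⟩
      rwa [GraphDom.op_single, GraphDom.incl_single, lp.inner_single_right,
        lp.inner_single_right, lp.inner_single_right, lp.inner_single_right] at this
    choose u h₁ h₂ h₃ h₄ using key
    have hg : (g, g') ∈ (directSum S)†.graph := by
      rw [adjoint_directSum hdense, mem_graph_directSum_iff]
      intro n
      rw [← h₁ n, ← h₂ n]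
      exact GraphDom.mem_graph (u n)
    obtain ⟨f, rfl, rfl⟩ := GraphDom.exists_of_mem_graph hg
    have hu : ∀ n, adjComp hdense n f = u n := fun n => GraphDom.incl_injective (h₁ n).symm
    rw [incl_mem_sumΓRel_iff P hdense]
    simp only [hu]
    exact ⟨h₃, h₄⟩

theorem sumΓRel_snd_unique {x : lp H 2} {y₁ y₂ : lp K 2 × lp K 2}
    (h₁ : (x, y₁) ∈ sumΓRel P) (h₂ : (x, y₂) ∈ sumΓRel P) : y₁ = y₂ := by
  obtain ⟨⟨f, z⟩, hf, hfz⟩ := h₁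
  obtain ⟨⟨g, w⟩, hg, hgw⟩ := h₂
  obtain ⟨rfl, rfl⟩ := Prod.ext_iff.1 hfz
  obtain ⟨hgf, rfl⟩ := Prod.ext_iff.1 hgw
  exact (sumΓPair P).mem_graph_snd_inj hf hg (GraphDom.incl_injective hgf).symm

end SumTriplets

section SumProperties

variable {H : ℕ → Type*} {K : ℕ → Type*}
  [∀ n, NormedAddCommGroup (H n)] [∀ n, InnerProductSpace ℂ (H n)] [∀ n, CompleteSpace (H n)]
  [∀ n, NormedAddCommGroup (K n)] [∀ n, InnerProductSpace ℂ (K n)]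
  {S : ∀ n, H n →ₗ.[ℂ] H n} (P : ∀ n, BoundaryTriplet (S n) (K n))
  (hdense : ∀ n, Dense ((S n).domain : Set (H n)))

/-! ### The Weyl function and the range of `Γ` -/

include hdense in
theorem weylRelation_sumΓRel {z : ℂ} (hz : z.im ≠ 0) :
    weylRelation (directSum S) (sumΓRel P) z = (directSum fun n => (P n).weyl z).graph := by
  refine SetLike.ext ?_
  rintro ⟨h, h'⟩
  rw [mem_graph_directSum_iff]
  constructor
  · rintro ⟨⟨x, l, l'⟩, ⟨hx, f, hf, hfx⟩, hl⟩ n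
    dsimp only [LinearMap.fst_apply, LinearMap.snd_apply] at hfx hl
    obtain ⟨rfl, rfl⟩ := Prod.ext_iff.1 hl
    subst hfx
    obtain ⟨h₀, h₁⟩ := (incl_mem_sumΓRel_iff P hdense).1 hx
    refine ((P n).mem_graph_weyl_iff hz).2 ⟨adjComp hdense n f, ?_, h₀ n, h₁ n⟩
    rw [mem_eigenDom_iff, op_adjComp, mem_eigenDom_iff.1 hf]
    rfl
  · intro hh
    choose u hu h₀ h₁ using fun n => ((P n).mem_graph_weyl_iff hz).1 (hh n)
    have hz' : 0 < |z.im| := abs_pos.2 hz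
    have hincl : Memℓp (fun n => GraphDom.incl (S n)† (u n)) 2 := by
      rw [memℓp_two_iff]
      -- The dominating series is `(‖h n‖² + ‖h' n‖²) / |Im z|`, from the eigenvector estimate and
      -- `ab ≤ a² + b²`.
      refine Summable.of_nonneg_of_le (fun n => sq_nonneg _) (fun n => ?_)
        (((memℓp_two_iff.1 (lp.memℓp h)).add (memℓp_two_iff.1 (lp.memℓp h'))).div_const |z.im|)
      have hb := (P n).abs_im_mul_norm_sq_le (hu n)
      rw [h₀, h₁] at hb
      rw [le_div_iff₀ hz']
      nlinarith [two_mul_le_add_sq ‖h n‖ ‖h' n‖, sq_nonneg ‖h n‖, sq_nonneg ‖h' n‖]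
    have hop : Memℓp (fun n => GraphDom.op (S n)† (u n)) 2 := by
      have : (fun n => GraphDom.op (S n)† (u n))
          = z • fun n => GraphDom.incl (S n)† (u n) := by
        funext n
        exact mem_eigenDom_iff.1 (hu n)
      rw [this]
      exact hincl.const_smul z
    obtain ⟨f, hf⟩ := GraphDom.exists_of_comp (adjoint_directSum hdense) u hincl hop
    refine ⟨(GraphDom.incl _ f, (h, h')), ⟨?_, f, ?_, rfl⟩, rfl⟩
    · refine (incl_mem_sumΓRel_iff P hdense).2 ⟨fun n => ?_, fun n => ?_⟩
      · rw [adjComp, hf, h₀]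
      · rw [adjComp, hf, h₁]
    · refine mem_eigenDom_iff.2 ?_
      ext n
      have hn := mem_eigenDom_iff.1 (hu n)
      rw [← hf n] at hn
      exact (op_adjComp hdense n f).symm.trans hn

include hdense in
theorem dense_range_sumΓPair : Dense (Set.range (sumΓPair P)) := by
  have hrange : Set.range (sumΓPair P) = (LinearMap.range (sumΓPair P).toFun : Set _) := rfl
  have hsingle : ∀ n (a b : K n), ((lp.single 2 n a : lp K 2), (lp.single 2 n b : lp K 2))
      ∈ LinearMap.range (sumΓPair P).toFun := by
    intro n a b
    obtain ⟨u, hu⟩ := (P n).surjective (a, b)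
    obtain ⟨rfl, rfl⟩ := Prod.ext_iff.1 hu
    exact LinearPMap.mem_range_iff.2 ⟨_, single_mem_graph_sumΓPair P hdense n u⟩
  have key : ∀ y, y ∈ (LinearMap.range (sumΓPair P).toFun).topologicalClosure := fun y =>
    (Submodule.isClosed_topologicalClosure _).mem_of_tendsto
      ((lp_hasSum_single y.1).prodMk (lp_hasSum_single y.2))
      (Filter.Eventually.of_forall fun s => Submodule.sum_mem _ fun n _ =>
        Submodule.le_topologicalClosure _ (hsingle n _ _))
  rw [hrange]
  exact key

/-! ### Closedness and boundedness -/

/-- Each component condition is continuous, and an intersection of closed sets is closed; no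
uniformity in `n` is involved. -/
theorem isClosed_setOf_Γ_eq {X : Type*} [TopologicalSpace X] (j : Fin 2)
    {a : X → GraphDom (directSum S)†} {b : X → lp K 2} (ha : Continuous a) (hb : Continuous b) :
    IsClosed {x | ∀ n, (P n).Γ j (adjComp hdense n (a x)) = b x n} := by
  simp only [Set.ofPred_forall]
  refine isClosed_iInter fun n => isClosed_eq ?_ ((lp_continuous_apply n).comp hb)
  exact ((P n).Γ j).continuous.comp ((GraphDom.continuous_comp _ n).comp ha)

include hdense in
theorem isClosed_sumΓ (j : Fin 2) : (sumΓ P j).IsClosed := by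
  have : ((sumΓ P j).graph : Set (GraphDom (directSum S)† × lp K 2))
      = {p | ∀ n, (P n).Γ j (adjComp hdense n p.1) = p.2 n} := by
    ext p
    exact mem_graph_sumΓ_iff P hdense
  rw [LinearPMap.IsClosed, this]
  exact isClosed_setOf_Γ_eq P hdense j continuous_fst continuous_snd

include hdense in
theorem isClosed_sumΓPair : (sumΓPair P).IsClosed := by
  have : ((sumΓPair P).graph : Set (GraphDom (directSum S)† × (lp K 2 × lp K 2)))
      = {p | ∀ n, (P n).Γ 0 (adjComp hdense n p.1) = p.2.1 n} ∩
        {p | ∀ n, (P n).Γ 1 (adjComp hdense n p.1) = p.2.2 n} := by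
    ext p
    exact mem_graph_sumΓPair_iff P hdense
  rw [LinearPMap.IsClosed, this]
  exact (isClosed_setOf_Γ_eq P hdense 0 continuous_fst (continuous_fst.comp continuous_snd)).inter
    (isClosed_setOf_Γ_eq P hdense 1 continuous_fst (continuous_snd.comp continuous_snd))

variable {P} in
/-- A uniform bound on the `Γ_j^(n)` makes `Γ_j` everywhere defined. -/
theorem SupFinite.memℓp {j : Fin 2} (h : SupFinite P j) (f : GraphDom (directSum S)†) :
    Memℓp (fun n => (P n).Γ j (adjComp hdense n f)) 2 := by
  obtain ⟨C, hC⟩ := h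
  rw [memℓp_two_iff]
  refine Summable.of_nonneg_of_le (fun n => sq_nonneg _) (fun n => ?_)
    ((GraphDom.summable_norm_comp_sq (adjoint_directSum hdense) f).mul_left (C ^ 2))
  rw [← mul_pow]
  refine pow_le_pow_left₀ (norm_nonneg _) ?_ 2
  exact ((P n).Γ j).le_of_opNorm_le (hC ⟨n, rfl⟩) _

include hdense in
theorem domain_sumΓ_eq_top {j : Fin 2} (h : SupFinite P j) : (sumΓ P j).domain = ⊤ :=
  Submodule.eq_top_iff'.2 fun f => (mem_domain_sumΓ_iff P hdense).2 (h.memℓp hdense f)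

include hdense in
theorem exists_sumΓ_eq_toPMap [∀ n, CompleteSpace (K n)] {j : Fin 2}
    (h : (sumΓ P j).domain = ⊤) : ∃ B : GraphDom (directSum S)† →L[ℂ] lp K 2,
      sumΓ P j = (B : GraphDom (directSum S)† →ₗ[ℂ] lp K 2).toPMap ⊤ := by
  have : CompleteSpace (GraphDom (directSum S)†) :=
    GraphDom.completeSpace (LinearPMap.adjoint_isClosed (dense_directSum_domain hdense))
  let L : GraphDom (directSum S)† →ₗ[ℂ] lp K 2 :=
    (sumΓ P j).toFun ∘ₗ (LinearEquiv.ofTop _ h).symm.toLinearMap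
  have hL : (L.graph : Set (GraphDom (directSum S)† × lp K 2)) = (sumΓ P j).graph := by
    ext ⟨f, g⟩
    have hf := (sumΓ P j).mem_graph ⟨f, h ▸ Submodule.mem_top⟩
    constructor
    · intro hg
      have : g = L f := hg
      rw [this]
      exact hf
    · intro hg
      exact (sumΓ P j).mem_graph_snd_inj hg hf rfl
  have hclosed : IsClosed (L.graph : Set (GraphDom (directSum S)† × lp K 2)) := by
    rw [hL]
    exact isClosed_sumΓ P hdense j
  -- Closed graph theorem on the complete space `dom A†`.
  refine ⟨⟨L, L.continuous_of_isClosed_graph hclosed⟩, ?_⟩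
  refine LinearPMap.ext h ?_
  intro f hf hf'
  rfl

include hdense in
-- The component embeddings are isometric for the graph norms, so `‖B‖` bounds every `‖Γ_j^(n)‖`.
theorem supFinite_of_sumΓ_eq_toPMap {j : Fin 2} {B : GraphDom (directSum S)† →L[ℂ] lp K 2}
    (h : sumΓ P j = (B : GraphDom (directSum S)† →ₗ[ℂ] lp K 2).toPMap ⊤) : SupFinite P j := by
  refine ⟨‖B‖, ?_⟩
  rintro - ⟨n, rfl⟩
  refine ContinuousLinearMap.opNorm_le_bound _ (norm_nonneg B) fun u => ?_
  have hmem : (adjSingle hdense n u, B (adjSingle hdense n u)) ∈ (sumΓ P j).graph := by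
    rw [h]
    exact LinearPMap.mem_graph ((B : GraphDom (directSum S)† →ₗ[ℂ] lp K 2).toPMap ⊤)
      ⟨adjSingle hdense n u, Submodule.mem_top⟩
  have hn := (mem_graph_sumΓ_iff P hdense).1 hmem n
  rw [GraphDom.comp_single_same] at hn
  calc ‖(P n).Γ j u‖ = ‖B (adjSingle hdense n u) n‖ := by rw [hn]
    _ ≤ ‖B (adjSingle hdense n u)‖ := lp.norm_apply_le_norm (by simp) _ n
    _ ≤ ‖B‖ * ‖adjSingle hdense n u‖ := B.le_opNorm _
    _ = ‖B‖ * ‖u‖ := by rw [GraphDom.norm_single]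

include hdense in
theorem domain_sumΓ_eq_top_iff [∀ n, CompleteSpace (K n)] {j : Fin 2} :
    (sumΓ P j).domain = ⊤ ↔ SupFinite P j := by
  refine ⟨fun h => ?_, domain_sumΓ_eq_top P hdense⟩
  obtain ⟨B, hB⟩ := exists_sumΓ_eq_toPMap P hdense h
  exact supFinite_of_sumΓ_eq_toPMap P hdense hB

include hdense in
theorem closure_sumΓ_tfae [∀ n, CompleteSpace (K n)] (j : Fin 2) : List.TFAE [
    (sumΓ P j).closure.domain = ⊤,
    ∃ B : GraphDom (directSum S)† →L[ℂ] lp K 2,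
      (sumΓ P j).closure = (B : GraphDom (directSum S)† →ₗ[ℂ] lp K 2).toPMap ⊤,
    SupFinite P j] := by
  -- Each `Γ_j` is already closed, so taking the closure changes nothing.
  rw [(isClosed_sumΓ P hdense j).closure_eq]
  tfae_have 1 → 2 := exists_sumΓ_eq_toPMap P hdense
  tfae_have 2 → 3 := fun ⟨_, hB⟩ => supFinite_of_sumΓ_eq_toPMap P hdense hB
  tfae_have 3 → 1 := domain_sumΓ_eq_top P hdense
  tfae_finish

include hdense in
theorem domain_sumΓPair_eq_top_iff [∀ n, CompleteSpace (K n)] :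
    (sumΓPair P).domain = ⊤ ↔ SupFinite P 0 ∧ SupFinite P 1 := by
  rw [← domain_sumΓ_eq_top_iff P hdense, ← domain_sumΓ_eq_top_iff P hdense]
  exact inf_eq_top_iff

/-! ### The extensions `A_{*j}` -/

include hdense in
theorem isSelfAdjoint_Atilde (hsymm : ∀ n, (S n).IsFormalAdjoint (S n)) (j : Fin 2) :
    IsSelfAdjoint (Atilde P j) := by
  rw [LinearPMap.isSelfAdjoint_def, Atilde,
    adjoint_directSum fun n => (P n).dense_ext_domain (hdense n) (hsymm n) j]
  congr
  funext n
  exact (P n).isSelfAdjoint_ext (hdense n) (hsymm n) j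

include hdense in
theorem AstarExt_le_Atilde (j : Fin 2) : AstarExt P j ≤ Atilde P j := by
  refine LinearPMap.le_of_le_graph ?_
  rintro ⟨x, y⟩ h
  obtain ⟨f, h₁, h₂, h₃, -⟩ := (mem_graph_AstarExt_iff P hdense).1 h
  exact (mem_graph_Atilde_iff P hdense).2 ⟨f, h₁, h₂, h₃⟩

include hdense in
theorem isClosable_AstarExt (hsymm : ∀ n, (S n).IsFormalAdjoint (S n)) (j : Fin 2) :
    (AstarExt P j).IsClosable :=
  (isSelfAdjoint_Atilde P hdense hsymm j).isClosed.isClosable.leIsClosable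
    (AstarExt_le_Atilde P hdense j)

include hdense in
theorem closure_AstarExt (hsymm : ∀ n, (S n).IsFormalAdjoint (S n)) (j : Fin 2) :
    (AstarExt P j).closure = Atilde P j := by
  have hcl := (isSelfAdjoint_Atilde P hdense hsymm j).isClosed
  refine le_antisymm ?_ (LinearPMap.le_of_le_graph ?_)
  · rw [← hcl.closure_eq]
    exact hcl.isClosable.closure_mono (AstarExt_le_Atilde P hdense j)
  · rw [← (isClosable_AstarExt P hdense hsymm j).graph_closure_eq_closure_graph]
    rintro ⟨x, y⟩ hxy
    obtain ⟨f, rfl, rfl, hf⟩ := (mem_graph_Atilde_iff P hdense).1 hxy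
    -- Truncations of an element of `dom Ã_j` stay in `ker Γ_j` and have finitely many nonzero
    -- boundary values, so they lie in `dom A_{*j}`.
    refine (Submodule.isClosed_topologicalClosure _).mem_of_tendsto
      ((lp_hasSum_single _).prodMk (lp_hasSum_single _))
      (Filter.Eventually.of_forall fun s => Submodule.sum_mem _ fun n _ =>
        Submodule.le_topologicalClosure _ ?_)
    refine (mem_graph_AstarExt_iff P hdense).2
      ⟨adjSingle hdense n (adjComp hdense n f), rfl, ?_, ?_, ?_⟩
    · rw [GraphDom.op_single, op_adjComp]
    · intro m
      rw [congrFun (Γ_adjComp_adjSingle P hdense n (adjComp hdense n f)) m, hf, lp.single_zero]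
      rfl
    · rw [Γ_adjComp_adjSingle P hdense n (adjComp hdense n f)]
      exact lp.memℓp _

include hdense in
theorem AstarExt_eq_Atilde {j : Fin 2} (h : SupFinite P (1 - j)) :
    AstarExt P j = Atilde P j := by
  refine le_antisymm (AstarExt_le_Atilde P hdense j) (LinearPMap.le_of_le_graph ?_)
  rintro ⟨x, y⟩ hxy
  obtain ⟨f, rfl, rfl, hf⟩ := (mem_graph_Atilde_iff P hdense).1 hxy
  exact (mem_graph_AstarExt_iff P hdense).2 ⟨f, rfl, rfl, hf, h.memℓp hdense f⟩

include hdense in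
theorem mem_domain_sumΓ_of_incl_mem_Atilde {j : Fin 2} {f : GraphDom (directSum S)†}
    (hf : GraphDom.incl _ f ∈ (Atilde P j).domain) : f ∈ (sumΓ P j).domain := by
  obtain ⟨y, hy⟩ := LinearPMap.mem_domain_iff.1 hf
  obtain ⟨g, hg, -, h0⟩ := (mem_graph_Atilde_iff P hdense).1 hy
  obtain rfl := GraphDom.incl_injective hg
  rw [mem_domain_sumΓ_iff P hdense, funext h0]
  exact zero_memℓp

include hdense in
/-- In the transversal case, self-adjointness of `A_{*j}` forces a uniform bound on the other
family of boundary maps. -/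
theorem supFinite_of_isSelfAdjoint_AstarExt [∀ n, CompleteSpace (K n)]
    (hsymm : ∀ n, (S n).IsFormalAdjoint (S n))
    (ht : IsTransversal (directSum S) (Atilde P 0) (Atilde P 1)) {j : Fin 2}
    (h : IsSelfAdjoint (AstarExt P j)) : SupFinite P (1 - j) := by
  -- A self-adjoint operator is closed, hence equal to its closure `Ã_j`.
  have heq : AstarExt P j = Atilde P j := by
    rw [← closure_AstarExt P hdense hsymm j, h.isClosed.closure_eq]
  have hsup : (Atilde P j).domain ⊔ (Atilde P (1 - j)).domain = (directSum S)†.domain := by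
    rw [← ht.sup_eq]
    fin_cases j
    · rfl
    · exact sup_comm _ _
  rw [← domain_sumΓ_eq_top_iff P hdense, Submodule.eq_top_iff']
  intro f
  have hf : GraphDom.incl _ f ∈ (directSum S)†.domain :=
    LinearPMap.mem_domain_of_mem_graph (GraphDom.mem_graph f)
  rw [← hsup] at hf
  obtain ⟨x, hx, y, hy, hxy⟩ := Submodule.mem_sup.1 hf
  rw [← heq] at hx
  obtain ⟨x', hx'⟩ := LinearPMap.mem_domain_iff.1 hx
  obtain ⟨g, rfl, -, -, hg⟩ := (mem_graph_AstarExt_iff P hdense).1 hx'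
  -- In `f = g + (f - g)` the first term has square-summable `Γ_{1-j}` values because it lies in
  -- `dom A_{*j}`; the second is in `dom Ã_{1-j}`, where these values vanish.
  have hsub : f - g ∈ (sumΓ P (1 - j)).domain := by
    refine mem_domain_sumΓ_of_incl_mem_Atilde P hdense ?_
    rwa [map_sub, ← hxy, add_sub_cancel_left]
  have := Submodule.add_mem _ hsub ((mem_domain_sumΓ_iff P hdense).2 hg)
  rwa [sub_add_cancel] at this

end SumProperties

end DirectSumTriplets

end

open DirectSumTriplets in
theorem theorem3p1 {H : ℕ → Type*} {K : ℕ → Type*}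
    [∀ n, NormedAddCommGroup (H n)] [∀ n, InnerProductSpace ℂ (H n)] [∀ n, CompleteSpace (H n)]
    [∀ n, NormedAddCommGroup (K n)] [∀ n, InnerProductSpace ℂ (K n)] [∀ n, CompleteSpace (K n)]
    (S : ∀ n, H n →ₗ.[ℂ] H n)
    (hdense : ∀ n, Dense ((S n).domain : Set (H n)))
    (hsymm : ∀ n, (S n).IsFormalAdjoint (S n))
    (P : ∀ n, BoundaryTriplet (S n) (K n)) :
    -- the adjoint of `A = ⨁ S n`
    (directSum S)† = directSum (fun n => (S n)†) ∧
    -- (i) `Γ` is a single-valued boundary relation for `A†`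
    (IsBoundaryRelation (directSum S) (sumΓRel P) ∧
      ∀ f y₁ y₂, (f, y₁) ∈ sumΓRel P → (f, y₂) ∈ sumΓRel P → y₁ = y₂) ∧
    -- (ii) the Weyl function of `Γ` is the direct sum of the bounded operators `M_n(z)`
    (∀ z : ℂ, z.im ≠ 0 →
      (∀ n, ∃ B : K n →L[ℂ] K n, (P n).weyl z = (B : K n →ₗ[ℂ] K n).toPMap ⊤) ∧
      weylRelation (directSum S) (sumΓRel P) z = (directSum fun n => (P n).weyl z).graph) ∧
    -- (iii) the range of `Γ` is dense
    Dense (Set.range (sumΓPair P)) ∧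
    -- (iv) `Γ` is closed, and the `Γ_j` are closable
    ((sumΓPair P).IsClosed ∧ ∀ j, (sumΓ P j).IsClosable) ∧
    -- (v) boundedness of the closures
    ((∀ j, List.TFAE [
        (sumΓ P j).closure.domain = ⊤,
        ∃ B : GraphDom (directSum S)† →L[ℂ] lp K 2,
          (sumΓ P j).closure = (B : GraphDom (directSum S)† →ₗ[ℂ] lp K 2).toPMap ⊤,
        SupFinite P j]) ∧
      ((sumΓPair P).domain = ⊤ ↔ SupFinite P 0 ∧ SupFinite P 1)) ∧
    -- (vi) essential self-adjointness
    (∀ j, IsEssentiallySelfAdjoint (AstarExt P j) ∧ (AstarExt P j).closure = Atilde P j) ∧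
    -- (vii) self-adjointness; the other index is `j' = 1 - j`
    (∀ j, (SupFinite P (1 - j) → IsSelfAdjoint (AstarExt P j) ∧ AstarExt P j = Atilde P j) ∧
      (IsTransversal (directSum S) (Atilde P 0) (Atilde P 1) →
        (IsSelfAdjoint (AstarExt P j) ↔ SupFinite P (1 - j)))) := by
  refine ⟨adjoint_directSum hdense,
    ⟨isBoundaryRelation_sumΓRel P hdense hsymm, fun _ _ _ => sumΓRel_snd_unique P⟩,
    fun z hz => ⟨fun n => (P n).exists_weyl_eq_toPMap (hdense n) (hsymm n) hz,
      weylRelation_sumΓRel P hdense hz⟩,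
    dense_range_sumΓPair P hdense,
    ⟨isClosed_sumΓPair P hdense, fun j => (isClosed_sumΓ P hdense j).isClosable⟩,
    ⟨closure_sumΓ_tfae P hdense, domain_sumΓPair_eq_top_iff P hdense⟩,
    fun j => ⟨⟨isClosable_AstarExt P hdense hsymm j, ?_⟩, closure_AstarExt P hdense hsymm j⟩,
    fun j => ?_⟩
  · rw [closure_AstarExt P hdense hsymm j]
    exact isSelfAdjoint_Atilde P hdense hsymm j
  · have hself : SupFinite P (1 - j) → IsSelfAdjoint (AstarExt P j) := fun h => by
      rw [AstarExt_eq_Atilde P hdense h]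
      exact isSelfAdjoint_Atilde P hdense hsymm j
    exact ⟨fun h => ⟨hself h, AstarExt_eq_Atilde P hdense h⟩,
      fun ht => ⟨supFinite_of_isSelfAdjoint_AstarExt P hdense hsymm ht, hself⟩⟩
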